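/- **Theorem 3.2 (two-sided exit).** Let $\mathbf E$ be a finite set and $\partial\notin\mathbf E$ an isolated coffin state. Let $(\mathsf\Lambda_s)_{s\ge0}$ be $\mathbf E\times\mathbf E$ matrices with non-negative off-diagonal entries and non-positive row sums, with $|\mathsf\Lambda_s(i,j)|\le K<\infty$ for all $s,i,j$. Let $v:\mathbf E\cup\{\partial\}\to\mathbb R$ satisfy $v(i)\ne0$ for $i\in\mathbf E$ and $v(\partial)=0$, and suppose that $\mathbf E_+=\{v>0\}$ and $\mathbf E_-=\{v<0\}$ are non-empty. Write $\mathbb R_+=[0,\infty)$, $\mathscr X=\mathbb R_+\times\mathbf E$ and $\mathscr X_\pm=\mathbb R_+\times\mathbf E_\pm$, and let an overline denote adjoining the point $(\infty,\partial)$. Let $\mathcal B_b(\cdot)$ be the space of bounded Borel functions vanishing at $(\infty,\partial)$. Let $(\mathbb P_{s,i})$ be a standard time-inhomogeneous Markov family on the càdlàg paths $X$ with values in $\mathbf E\cup\{\partial\}$, that is: $\mathbb P_{s,i}(X_s=i)=1$, the state $\partial$ is absorbing, the Markov and strong Markov properties hold with respect to the filtrations $\mathscr F^s_t=\bigcap_{r>t}\sigma(X_u:s\le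 u\le r)$, and $X$ is quasi-left-continuous before its lifetime. Let $(\mathsf\Lambda_s)$ be its generators: $\lim_{h\downarrow0}h^{-1}\big(\mathbb E_{s,i}f(X_{s+h})-f(i)\big)=(\mathsf\Lambda_sf)(i)$ for all $(s,i)\in\mathscr X$ and $f:\mathbf E\to\mathbb R$, with $f(\partial)=0$. Put $X_\infty=\partial$, $\phi_t(s)=\int_s^tv(X_u)\,du$ for $t\in[s,\infty)$ and $\phi_\infty(s)=0$. For $\ell,\ell^\pm\ge0$ (with $\inf\emptyset=\infty$) let $$\tau^+_\ell(s)=\inf\{t\in[s,\infty]:\phi_t(s)>\ell\},\qquad \tau^-_\ell(s)=\inf\{t\in[s,\infty]:\phi_t(s)<-\ell\},$$ $$\xi^+(s)=\inf\{t\in[s,\tau^-_{\ell^-}(s)):\phi_t(s)>\ell^+\},\qquad \xi^-(s)=\inf\{t\in[s,\tau^+_{\ell^+}(s)):\phi_t(s)<-\ell^-\}.$$ For $g^\pm\in\mathcal B_b(\overline{\mathscr X_\pm})$ define $$(J^\pm g^\pm)(s,i)=\mathbb E_{s,i}\,g^\pm(\tau^\pm_0,X_{\tau^\pm_0})\ \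 (i\in\mathbf E_\mp),\qquad(\mathcal P^\pm_\ell g^\pm)(s,i)=\mathbb E_{s,i}\,g^\pm(\tau^\pm_\ell,X_{\tau^\pm_\ell})\ \ (i\in\mathbf E_\pm),$$ $$(\Xi^\pm_{\ell^-,\ell^+}g^\pm)(s,i)=\mathbb E_{s,i}\,g^\pm(\xi^\pm,X_{\xi^\pm})\ \ (i\in\mathbf E).$$ In block columns the $\mathbf E_+$-block stands above the $\mathbf E_-$-block, and $I^\pm$ is the identity. Fix $\ell^-,\ell^+\ge0$. Then $J^\pm$, $\mathcal P^\pm_\ell$ ($\ell\ge 0$) and $\Xi^\pm_{\ell^-,\ell^+}$ map bounded Borel functions to bounded Borel functions: $J^\pm:\mathcal B_b(\overline{\mathscr X_\pm})\to\mathcal B_b(\overline{\mathscr X_\mp})$, $\mathcal P^\pm_\ell:\mathcal B_b(\overline{\mathscr X_\pm})\to\mathcal B_b(\overline{\mathscr X_\pm})$, $\Xi^\pm_{\ell^-,\ell^+}:\mathcal B_b(\overline{\mathscr X_\pm})\to\mathcal B_b(\overline{\mathscr X})$. If $g^\pm\in\mathcal B_b(\overline{\mathscr X_\pm})$ decay exponentially,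 i.e. $|g^\pm(s,i)|\le Ce^{-cs}$ for some $C,c>0$ and all $(s,i)\in\mathscr X_\pm$, then the series below converge in $\|\cdot\|_\infty$ and, for every $(s,i)\in\mathscr X$, $$(\Xi^+_{\ell^-,\ell^+}g^+)(s,i)=\Big[\Big(\tbinom{I^+}{J^+}\mathcal P^+_{\ell^+}-\tbinom{J^-}{I^-}\mathcal P^-_{\ell^-}J^+\mathcal P^+_{\ell^-+\ell^+}\Big)\sum_{n=0}^\infty\big(J^-\mathcal P^-_{\ell^-+\ell^+}J^+\mathcal P^+_{\ell^-+\ell^+}\big)^ng^+\Big](s,i),$$ $$(\Xi^-_{\ell^-,\ell^+}g^-)(s,i)=\Big[\Big(\tbinom{J^-}{I^-}\mathcal P^-_{\ell^-}-\tbinom{I^+}{J^+}\mathcal P^+_{\ell^+}J^-\mathcal P^-_{\ell^-+\ell^+}\Big)\sum_{n=0}^\infty\big(J^+\mathcal P^+_{\ell^-+\ell^+}J^-\mathcal P^-_{\ell^-+\ell^+}\big)^ng^-\Big](s,i).$$ Moreover, for every $g\in\mathcal B_b(\overline{\mathscr X})$ with restrictions $g^\pm$ to $\overline{\mathscr X_\pm}$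 and every $(s,i)\in\mathscr X$, $$\mathbb E_{s,i}\big(g(\tau^-_{\ell^-}\wedge\tau^+_{\ell^+},X_{\tau^-_{\ell^-}\wedge\tau^+_{\ell^+}})\big)=(\Xi^+_{\ell^-,\ell^+}g^+)(s,i)+(\Xi^-_{\ell^-,\ell^+}g^-)(s,i).$$ -/

import Mathlib

open MeasureTheory ProbabilityTheory Filter Topology
open scoped NNReal

noncomputable section

namespace TwoSidedExit

/-! ### Paths, filtrations and generators -/

/-- The canonical path space: càdlàg functions from `[0, ∞)` to the finite discrete space
`E ∪ {∂}`. The set `E ∪ {∂}` is modelled by `Option E`, the coffin state `∂` by `none`. -/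
def CadlagPath (E : Type*) : Type _ :=
  {ω : ℝ≥0 → Option E //
    (∀ t, ∀ᶠ u in 𝓝[>] t, ω u = ω t) ∧ ∀ t, ∃ x, ∀ᶠ u in 𝓝[<] t, ω u = x}

/-- The coordinate process at finite times. -/
def coord {E : Type*} (t : ℝ≥0) (ω : CadlagPath E) : Option E := ω.1 t

/-- The coordinate process at times in `[0, ∞]`, with `X_∞ = ∂`. -/
def coordTop {E : Type*} (ω : CadlagPath E) : WithTop ℝ≥0 → Option E
  | some t => coord t ω
  | none => none

/-- The `σ`-field generated by all coordinates. -/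
instance instMeasurableSpaceCadlagPath {E : Type*} : MeasurableSpace (CadlagPath E) :=
  ⨆ t : ℝ≥0, MeasurableSpace.comap (coord t) ⊤

/-- `σ(X_u : u ∈ [s, r])`. -/
@[reducible] def sigmaBetween {E : Type*} (s r : ℝ≥0) : MeasurableSpace (CadlagPath E) :=
  ⨆ u : ℝ≥0, ⨆ _ : s ≤ u ∧ u ≤ r, MeasurableSpace.comap (coord u) ⊤

theorem sigmaBetween_le {E : Type*} (s r : ℝ≥0) :
    sigmaBetween s r ≤ (instMeasurableSpaceCadlagPath : MeasurableSpace (CadlagPath E)) :=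
  iSup_le fun u => iSup_le fun _ =>
    le_iSup (fun t : ℝ≥0 => MeasurableSpace.comap (coord (E := E) t) ⊤) u

/-- The right-continuous filtration `𝓕ˢ_t = ⋂_{r > t} σ(X_u : u ∈ [s, r])`. -/
def filt {E : Type*} (s : ℝ≥0) :
    Filtration ℝ≥0 (instMeasurableSpaceCadlagPath : MeasurableSpace (CadlagPath E)) where
  seq t := ⨅ r : ℝ≥0, ⨅ _ : t < r, sigmaBetween s r
  mono' _ _ h := le_iInf fun r => le_iInf fun hr => iInf₂_le r (lt_of_le_of_lt h hr)
  le' t := (iInf₂_le (t + 1) (lt_add_of_pos_right t one_pos)).trans (sigmaBetween_le s (t + 1))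

/-- A family of sub-Markovian generator matrices: the off-diagonal entries are non-negative and
the row sums are non-positive. -/
def IsSubMarkovGenerator {E : Type*} [Fintype E] (Λ : ℝ≥0 → Matrix E E ℝ) : Prop :=
  (∀ s i j, i ≠ j → 0 ≤ Λ s i j) ∧ ∀ s i, ∑ j, Λ s i j ≤ 0

/-- A function on `E` extended by `0` to the coffin state. -/
def extCoffin {E : Type*} (f : E → ℝ) : Option E → ℝ
  | some i => f i
  | none => 0

/-- A standard time-inhomogeneous Markov family with state space `E ∪ {∂}` on the canonical path
space, with generators `Λ_s`. Only the restriction of `P s x` to `σ(X_u : u ≥ s)` matters.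
A killed chain stays in the coffin state. -/
structure StandardMarkovFamily (E : Type*) [Fintype E] (Λ : ℝ≥0 → Matrix E E ℝ) where
  /-- The law `P_{s,x}` of the chain started at time `s` in the state `x`. -/
  P : ℝ≥0 → Option E → Measure (CadlagPath E)
  isProb : ∀ s x, IsProbabilityMeasure (P s x)
  start : ∀ s x, ∀ᵐ ω ∂(P s x), coord s ω = x
  absorbing : ∀ s t, s ≤ t → ∀ᵐ ω ∂(P s none), coord t ω = none
  /-- The Markov property `P_{s,x}(X_r ∈ B | 𝓕ˢ_t) = P_{t,X_t}(X_r ∈ B)` a.s. -/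
  markov : ∀ (s : ℝ≥0) (x : Option E) (t r : ℝ≥0) (B : Set (Option E)), s ≤ t → t ≤ r →
    (P s x)[{ω | coord r ω ∈ B}.indicator (fun _ => (1 : ℝ)) | filt s t]
      =ᵐ[P s x] fun ω => (P t (coord t ω)).real {ω' | coord r ω' ∈ B}
  /-- The strong Markov property
  `P_{s,x}(X_{τ+t} ∈ B | 𝓕ˢ_τ) = P_{τ,X_τ}(X_{τ+t} ∈ B)` a.s. on `{τ < ∞}`. -/
  strongMarkov : ∀ (s : ℝ≥0) (x : Option E) (τ : CadlagPath E → WithTop ℝ≥0)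
    (hτ : IsStoppingTime (filt s) τ), (∀ ω, (s : WithTop ℝ≥0) ≤ τ ω) →
    ∀ (t : ℝ≥0) (B : Set (Option E)),
    (P s x)[{ω | τ ω ≠ ⊤ ∧ coord ((τ ω).untopD 0 + t) ω ∈ B}.indicator (fun _ => (1 : ℝ)) |
        hτ.measurableSpace]
      =ᵐ[P s x] {ω | τ ω ≠ ⊤}.indicator fun ω =>
        (P ((τ ω).untopD 0) (coordTop ω (τ ω))).real
          {ω' | coord ((τ ω).untopD 0 + t) ω' ∈ B}
  /-- Quasi-left-continuity before the lifetime: if stopping times `τ n` increase to `σ`, then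
  `X_{τ n} → X_σ` a.s. on the event that `σ < ∞` and the chain is not yet killed at `σ`. -/
  quasiLeftCont : ∀ (s : ℝ≥0) (x : Option E) (τ : ℕ → CadlagPath E → WithTop ℝ≥0),
    (∀ n, IsStoppingTime (filt s) (τ n)) → (∀ n ω, (s : WithTop ℝ≥0) ≤ τ n ω) →
    (∀ ω, Monotone fun n => τ n ω) →
    ∀ᵐ ω ∂(P s x), coordTop ω (⨆ n, τ n ω) ≠ none →
      ∀ᶠ n in atTop, coordTop ω (τ n ω) = coordTop ω (⨆ n, τ n ω)
  /-- `Λ_s` is the right derivative at `t = s` of `U_{s,t} f (i) = 𝔼_{s,i} f(X_t)`, where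
  `f(∂) = 0`. -/
  generator : ∀ (s : ℝ≥0) (i : E) (f : E → ℝ),
    Tendsto
      (fun h : ℝ≥0 => ((∫ ω, extCoffin f (coord (s + h) ω) ∂(P s (some i))) - f i) / (h : ℝ))
      (𝓝[>] 0) (𝓝 ((Λ s).mulVec f i))

/-! ### The additive functional and the passage times -/

/-- `φ_t(s) = ∫_s^t v(X_u) du` for `t < ∞`, with `v(∂) = 0`, and `φ_∞(s) = 0`. -/
def phi {E : Type*} (v : E → ℝ) (s : ℝ≥0) (ω : CadlagPath E) : WithTop ℝ≥0 → ℝ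
  | some t => ∫ u in (s : ℝ)..(t : ℝ), extCoffin v (coord u.toNNReal ω)
  | none => 0

/-- `τ⁺_ℓ(s) = inf {t ∈ [s, ∞] : φ_t(s) > ℓ}`. -/
def tauPlus {E : Type*} (v : E → ℝ) (ℓ s : ℝ≥0) (ω : CadlagPath E) : WithTop ℝ≥0 :=
  sInf {t | (s : WithTop ℝ≥0) ≤ t ∧ (ℓ : ℝ) < phi v s ω t}

/-- `τ⁻_ℓ(s) = inf {t ∈ [s, ∞] : φ_t(s) < -ℓ}`. -/
def tauMinus {E : Type*} (v : E → ℝ) (ℓ s : ℝ≥0) (ω : CadlagPath E) : WithTop ℝ≥0 :=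
  sInf {t | (s : WithTop ℝ≥0) ≤ t ∧ phi v s ω t < -(ℓ : ℝ)}

/-- `ξ⁺_{ℓ⁻,ℓ⁺}(s) = inf {t ∈ [s, τ⁻_{ℓ⁻}(s)) : φ_t(s) > ℓ⁺}`. -/
def xiPlus {E : Type*} (v : E → ℝ) (ℓm ℓp s : ℝ≥0) (ω : CadlagPath E) : WithTop ℝ≥0 :=
  sInf {t | (s : WithTop ℝ≥0) ≤ t ∧ t < tauMinus v ℓm s ω ∧ (ℓp : ℝ) < phi v s ω t}

/-- `ξ⁻_{ℓ⁻,ℓ⁺}(s) = inf {t ∈ [s, τ⁺_{ℓ⁺}(s)) : φ_t(s) < -ℓ⁻}`. -/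
def xiMinus {E : Type*} (v : E → ℝ) (ℓm ℓp s : ℝ≥0) (ω : CadlagPath E) : WithTop ℝ≥0 :=
  sInf {t | (s : WithTop ℝ≥0) ≤ t ∧ t < tauPlus v ℓp s ω ∧ phi v s ω t < -(ℓm : ℝ)}

/-! ### Function spaces -/

/-- `E₊ = {v > 0}`. -/
abbrev EPlus {E : Type*} (v : E → ℝ) : Type _ := {i : E // 0 < v i}

/-- `E₋ = {v < 0}`. -/
abbrev EMinus {E : Type*} (v : E → ℝ) : Type _ := {i : E // v i < 0}

/-- Membership in the space of bounded Borel functions on `([0, ∞) × S) ∪ {(∞, ∂)}` that vanish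
at `(∞, ∂)`, for a finite discrete set `S`. Such a function is given by its restriction `g` to
`[0, ∞) × S`. -/
def IsBb {S : Type*} (g : ℝ≥0 → S → ℝ) : Prop :=
  (∀ i, Measurable fun s => g s i) ∧ ∃ C : ℝ, ∀ s i, |g s i| ≤ C

/-- Exponentially fast decay to zero in time. -/
def ExpDecay {S : Type*} (g : ℝ≥0 → S → ℝ) : Prop :=
  ∃ C c : ℝ, 0 < C ∧ 0 < c ∧ ∀ s i, |g s i| ≤ C * Real.exp (-c * (s : ℝ))

open Classical in
/-- Evaluation at a point of `[0, ∞] × (E ∪ {∂})` of a function given on `[0, ∞) × S`, `S ⊆ E`: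
the value is `0` off `[0, ∞) × S`, in particular at `(∞, ∂)`. -/
def evalAt {E : Type*} {p : E → Prop} (g : ℝ≥0 → {i : E // p i} → ℝ) :
    WithTop ℝ≥0 → Option E → ℝ
  | some t, some i => if h : p i then g t ⟨i, h⟩ else 0
  | _, _ => 0

/-- The same for a function given on `[0, ∞) × E`. -/
def evalAtFull {E : Type*} (g : ℝ≥0 → E → ℝ) : WithTop ℝ≥0 → Option E → ℝ
  | some t, some i => g t i
  | _, _ => 0

open Classical in
/-- The function on `[0, ∞) × E` whose restrictions to `[0, ∞) × E₊` and `[0, ∞) × E₋` are `f`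
and `g` (a time-dependent column vector with blocks `f` and `g`). -/
def stack {E : Type*} {v : E → ℝ} (f : ℝ≥0 → EPlus v → ℝ) (g : ℝ≥0 → EMinus v → ℝ) :
    ℝ≥0 → E → ℝ :=
  fun s i => if h : 0 < v i then f s ⟨i, h⟩ else if h' : v i < 0 then g s ⟨i, h'⟩ else 0

/-! ### The exit operators -/

section Operators

variable {E : Type*} [Fintype E] {Λ : ℝ≥0 → Matrix E E ℝ} (M : StandardMarkovFamily E Λ)
  (v : E → ℝ)

/-- `(J⁺ g)(s, i) = 𝔼_{s,i} g(τ⁺_0, X_{τ⁺_0})` for `i ∈ E₋`. -/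
def Jplus (g : ℝ≥0 → EPlus v → ℝ) : ℝ≥0 → EMinus v → ℝ := fun s i =>
  ∫ ω, evalAt g (tauPlus v 0 s ω) (coordTop ω (tauPlus v 0 s ω)) ∂(M.P s (some i))

/-- `(J⁻ g)(s, i) = 𝔼_{s,i} g(τ⁻_0, X_{τ⁻_0})` for `i ∈ E₊`. -/
def Jminus (g : ℝ≥0 → EMinus v → ℝ) : ℝ≥0 → EPlus v → ℝ := fun s i =>
  ∫ ω, evalAt g (tauMinus v 0 s ω) (coordTop ω (tauMinus v 0 s ω)) ∂(M.P s (some i))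

/-- `(𝓟⁺_ℓ g)(s, i) = 𝔼_{s,i} g(τ⁺_ℓ, X_{τ⁺_ℓ})` for `i ∈ E₊`. -/
def Pplus (ℓ : ℝ≥0) (g : ℝ≥0 → EPlus v → ℝ) : ℝ≥0 → EPlus v → ℝ := fun s i =>
  ∫ ω, evalAt g (tauPlus v ℓ s ω) (coordTop ω (tauPlus v ℓ s ω)) ∂(M.P s (some i))

/-- `(𝓟⁻_ℓ g)(s, i) = 𝔼_{s,i} g(τ⁻_ℓ, X_{τ⁻_ℓ})` for `i ∈ E₋`. -/
def Pminus (ℓ : ℝ≥0) (g : ℝ≥0 → EMinus v → ℝ) : ℝ≥0 → EMinus v → ℝ := fun s i =>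
  ∫ ω, evalAt g (tauMinus v ℓ s ω) (coordTop ω (tauMinus v ℓ s ω)) ∂(M.P s (some i))

/-- `(Ξ⁺_{ℓ⁻,ℓ⁺} g)(s, i) = 𝔼_{s,i} g(ξ⁺, X_{ξ⁺})` for `i ∈ E`. -/
def XiPlus (ℓm ℓp : ℝ≥0) (g : ℝ≥0 → EPlus v → ℝ) : ℝ≥0 → E → ℝ := fun s i =>
  ∫ ω, evalAt g (xiPlus v ℓm ℓp s ω) (coordTop ω (xiPlus v ℓm ℓp s ω)) ∂(M.P s (some i))

/-- `(Ξ⁻_{ℓ⁻,ℓ⁺} g)(s, i) = 𝔼_{s,i} g(ξ⁻, X_{ξ⁻})` for `i ∈ E`. -/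
def XiMinus (ℓm ℓp : ℝ≥0) (g : ℝ≥0 → EMinus v → ℝ) : ℝ≥0 → E → ℝ := fun s i =>
  ∫ ω, evalAt g (xiMinus v ℓm ℓp s ω) (coordTop ω (xiMinus v ℓm ℓp s ω)) ∂(M.P s (some i))

/-- `𝔼_{s,i} g(τ⁻_{ℓ⁻} ∧ τ⁺_{ℓ⁺}, X_{τ⁻_{ℓ⁻} ∧ τ⁺_{ℓ⁺}})`. -/
def twoSidedExit (ℓm ℓp : ℝ≥0) (g : ℝ≥0 → E → ℝ) : ℝ≥0 → E → ℝ := fun s i =>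
  ∫ ω, evalAtFull g (min (tauMinus v ℓm s ω) (tauPlus v ℓp s ω))
    (coordTop ω (min (tauMinus v ℓm s ω) (tauPlus v ℓp s ω))) ∂(M.P s (some i))

/-- The column operator `(I⁺ ; J⁺)`. -/
def colPlus (f : ℝ≥0 → EPlus v → ℝ) : ℝ≥0 → E → ℝ := stack f (Jplus M v f)

/-- The column operator `(J⁻ ; I⁻)`. -/
def colMinus (f : ℝ≥0 → EMinus v → ℝ) : ℝ≥0 → E → ℝ := stack (Jminus M v f) f

/-- `J⁻ 𝓟⁻_ℓ J⁺ 𝓟⁺_ℓ`. -/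
def loopPlus (ℓ : ℝ≥0) (g : ℝ≥0 → EPlus v → ℝ) : ℝ≥0 → EPlus v → ℝ :=
  Jminus M v (Pminus M v ℓ (Jplus M v (Pplus M v ℓ g)))

/-- `J⁺ 𝓟⁺_ℓ J⁻ 𝓟⁻_ℓ`. -/
def loopMinus (ℓ : ℝ≥0) (g : ℝ≥0 → EMinus v → ℝ) : ℝ≥0 → EMinus v → ℝ :=
  Jplus M v (Pplus M v ℓ (Jminus M v (Pminus M v ℓ g)))

end Operators

/-- The series `∑_{n ≥ 0} Aⁿ g`. -/
def neumann {S : Type*} (A : (ℝ≥0 → S → ℝ) → (ℝ≥0 → S → ℝ)) (g : ℝ≥0 → S → ℝ) :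
    ℝ≥0 → S → ℝ := fun s i => ∑' n : ℕ, (A^[n]) g s i

/-- The series `∑_{n ≥ 0} Aⁿ g` converges in the supremum norm (to `neumann A g`). -/
def NeumannConverges {S : Type*} (A : (ℝ≥0 → S → ℝ) → (ℝ≥0 → S → ℝ)) (g : ℝ≥0 → S → ℝ) : Prop :=
  TendstoUniformly (fun (N : ℕ) (z : ℝ≥0 × S) => ∑ n ∈ Finset.range N, (A^[n]) g z.1 z.2)
    (fun z => neumann A g z.1 z.2) atTop

end TwoSidedExit

end

open TwoSidedExit

/-!
The operators on block columns are first replaced by operators on functions on all of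
`[0, ∞) × E`: the passage operators `H⁺_ℓ G = 𝔼 G(τ⁺_ℓ, X_{τ⁺_ℓ})` (`passage` for `v`), `H⁻_ℓ` (`passage`
for `-v`) and the exit operators `X⁺`, `X⁻` (`exitUp` for `v` and for `-v`). At a finite passage
time the chain is in the right half of the state space (`coord_tauPlus`), so that nothing is lost,
and passing the level `ℓ` includes passing the level `0`, so that `H⁺_0 H⁺_ℓ = H⁺_ℓ`
(`passage_zero_passage`) and the operators `J^±` disappear.

Splitting an upward passage according to the end through which `φ` first leaves `[-ℓ⁻, ℓ⁺]` gives
`H⁺_{ℓ⁺} = X⁺ + X⁻ H⁺_{ℓ⁻+ℓ⁺}` (`passage_eq_exitUp_add`), and likewise for the downward passage.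
Eliminating `X⁻` yields `H⁺_{ℓ⁺} - H⁻_{ℓ⁻} H⁺_{ℓ⁻+ℓ⁺} = X⁺ (1 - H⁻_{ℓ⁻+ℓ⁺} H⁺_{ℓ⁻+ℓ⁺})`, and the
Neumann series inverts the last factor (`exitUp_eq_of_series`).

Two analytic facts carry this. The strong Markov property is given for one time after the stopping
time only. It extends to cylinder sets, by absorbing the first of the times into the stopping
time, and then to all functionals of the future path (`strongMarkov_integral`). Borel dependence
on the starting time comes from the right-continuity of the transition probabilities in the
starting time (`tendsto_transProb`), which the right-continuity of the paths and the Markov property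
imply.

The series converges because every loop contains a passage that starts on the wrong side, hence
needs a jump between living states. The probability of such a jump within a time `δ` is at most
linear in `δ`, uniformly in the starting point (`measureReal_tauPlus_lt_le`): the generators bound
the right derivative of the probability of being in a given set of living states, and
quasi-left-continuity excludes upward jumps of this probability. So the loop operator contracts exponentially
decaying functions by a factor `q < 1` (`exists_passage_contraction`).
-/

noncomputable section
namespace TwoSidedExit

section

/-! ### Joint measurability of right-continuous processes -/

/-- The point of the grid `ℕ / (n + 1)` next to the right of `t`. -/
def gridRight (n : ℕ) (t : ℝ≥0) : ℝ≥0 := (⌊((n : ℝ≥0) + 1) * t⌋₊ + 1 : ℕ) / ((n : ℝ≥0) + 1)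

theorem lt_gridRight (n : ℕ) (t : ℝ≥0) : t < gridRight n t := by
  rw [gridRight, lt_div_iff₀ (by positivity), mul_comm]
  push_cast
  exact Nat.lt_floor_add_one _

theorem gridRight_le (n : ℕ) (t : ℝ≥0) : gridRight n t ≤ t + 1 / ((n : ℝ≥0) + 1) := by
  rw [gridRight, div_le_iff₀ (by positivity), add_mul t,
    div_mul_cancel₀ _ (by positivity), mul_comm]
  push_cast
  gcongr
  rw [mul_comm]
  exact Nat.floor_le (by positivity)

theorem tendsto_gridRight (t : ℝ≥0) : Tendsto (fun n => gridRight n t) atTop (𝓝[>] t) := by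
  refine tendsto_nhdsWithin_iff.2 ⟨?_, Eventually.of_forall fun n => lt_gridRight n t⟩
  have h : Tendsto (fun n : ℕ => t + 1 / ((n : ℝ≥0) + 1)) atTop (𝓝 (t + 0)) :=
    tendsto_const_nhds.add tendsto_one_div_add_atTop_nhds_zero_nat
  rw [add_zero] at h
  exact tendsto_of_tendsto_of_tendsto_of_le_of_le tendsto_const_nhds h
    (fun n => (lt_gridRight n t).le) fun n => gridRight_le n t

theorem measurable_uncurry_of_rightContinuous {Ω : Type*} [MeasurableSpace Ω] {f : ℝ≥0 → Ω → ℝ}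
    (hf : ∀ t, Measurable (f t)) (hr : ∀ t ω, Tendsto (fun u => f u ω) (𝓝[>] t) (𝓝 (f t ω))) :
    Measurable fun p : ℝ≥0 × Ω => f p.1 p.2 := by
  refine measurable_of_tendsto_metrizable (f := fun n (p : ℝ≥0 × Ω) => f (gridRight n p.1) p.2)
    (fun n => ?_) (tendsto_pi_nhds.2 fun p => (hr p.1 p.2).comp (tendsto_gridRight p.1))
  have h1 : Measurable fun q : ℕ × Ω => f (((q.1 + 1 : ℕ) : ℝ≥0) / ((n : ℝ≥0) + 1)) q.2 :=
    measurable_from_prod_countable_right fun k => hf (((k + 1 : ℕ) : ℝ≥0) / ((n : ℝ≥0) + 1))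
  have h2 : Measurable fun p : ℝ≥0 × Ω => (⌊((n : ℝ≥0) + 1) * p.1⌋₊, p.2) :=
    (Nat.measurable_floor.comp (measurable_fst.const_mul _)).prodMk measurable_snd
  exact h1.comp h2

/-! ### Time changes of càdlàg paths -/

/-- The finite state space carries the discrete `σ`-field. -/
instance instMeasurableSpaceOption {E : Type*} : MeasurableSpace (Option E) := ⊤

instance {E : Type*} : DiscreteMeasurableSpace (Option E) := ⟨fun _ => trivial⟩

variable {E : Type*}

theorem measurable_coord (t : ℝ≥0) : Measurable (coord (E := E) t) := by
  rw [measurable_iff_comap_le]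
  exact le_iSup (fun t : ℝ≥0 => MeasurableSpace.comap (coord (E := E) t) ⊤) t

theorem measurable_cadlagPath {α : Type*} {mα : MeasurableSpace α} {f : α → CadlagPath E}
    (hf : ∀ t, Measurable fun a => coord t (f a)) : Measurable f := by
  rw [measurable_iff_comap_le, instMeasurableSpaceCadlagPath, MeasurableSpace.comap_iSup]
  refine iSup_le fun t => ?_
  rw [MeasurableSpace.comap_comp]
  exact measurable_iff_comap_le.1 (hf t)

theorem coord_rightCont (ω : CadlagPath E) (t : ℝ≥0) : ∀ᶠ u in 𝓝[>] t, coord u ω = coord t ω :=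
  ω.2.1 t

/-- A path run along a continuous monotone clock. -/
def timeChange (c : ℝ≥0 → ℝ≥0) (hm : Monotone c) (hc : Continuous c) (ω : CadlagPath E) :
    CadlagPath E :=
  ⟨fun t => coord (c t) ω, by
    intro t
    have h1 : Tendsto c (𝓝[>] t) (𝓝[≥] c t) := tendsto_nhdsWithin_iff.2
      ⟨(hc.tendsto t).mono_left nhdsWithin_le_nhds,
        eventually_nhdsWithin_of_forall fun u hu => hm (le_of_lt hu)⟩
    have h2 : ∀ᶠ u in 𝓝[≥] c t, coord u ω = coord (c t) ω := by
      rw [← Set.Ioi_insert, nhdsWithin_insert, eventually_sup]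
      exact ⟨by simp, coord_rightCont ω (c t)⟩
    exact h1.eventually h2, by
    intro t
    by_cases h : ∃ u < t, c u = c t
    · obtain ⟨u, hu, hut⟩ := h
      refine ⟨coord (c t) ω, ?_⟩
      filter_upwards [Ioo_mem_nhdsLT hu] with r hr
      rw [le_antisymm (hm hr.2.le) (hut ▸ hm hr.1.le)]
    · push Not at h
      obtain ⟨x, hx⟩ := ω.2.2 (c t)
      refine ⟨x, Tendsto.eventually (tendsto_nhdsWithin_iff.2
        ⟨(hc.tendsto t).mono_left nhdsWithin_le_nhds,
          eventually_nhdsWithin_of_forall fun u hu => ?_⟩) hx⟩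
      exact lt_of_le_of_ne (hm (le_of_lt hu)) (h u hu)⟩

@[simp] theorem coord_timeChange (c : ℝ≥0 → ℝ≥0) (hm : Monotone c) (hc : Continuous c)
    (ω : CadlagPath E) (t : ℝ≥0) : coord t (timeChange c hm hc ω) = coord (c t) ω := rfl

/-- The shifted path `u ↦ X_{s + u}`. -/
def shift (s : ℝ≥0) : CadlagPath E → CadlagPath E :=
  timeChange (fun u => s + u) (fun _ _ h => add_le_add le_rfl h) (by fun_prop)

@[simp] theorem coord_shift (s t : ℝ≥0) (ω : CadlagPath E) :
    coord t (shift s ω) = coord (s + t) ω := rfl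

theorem cadlagPath_ext {ω ω' : CadlagPath E} (h : ∀ t, coord t ω = coord t ω') : ω = ω' :=
  Subtype.ext (funext h)

theorem shift_shift (s t : ℝ≥0) (ω : CadlagPath E) : shift t (shift s ω) = shift (s + t) ω :=
  cadlagPath_ext fun u => by simp [add_assoc]

/-- The path frozen outside the time interval `[s, r]`. -/
def freeze (s r : ℝ≥0) : CadlagPath E → CadlagPath E :=
  timeChange (fun u => max s (min u r)) 
    (fun _ _ h => max_le_max le_rfl (min_le_min h le_rfl)) (by fun_prop)

theorem coord_freeze {s r u : ℝ≥0} (hs : s ≤ u) (hr : u ≤ r) (ω : CadlagPath E) :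
    coord u (freeze s r ω) = coord u ω := by
  change coord (max s (min u r)) ω = _
  rw [min_eq_left hr, max_eq_right hs]

theorem measurable_coord_sigmaBetween {s r u : ℝ≥0} (hs : s ≤ u) (hr : u ≤ r) :
    Measurable[sigmaBetween s r] (coord (E := E) u) := by
  rw [measurable_iff_comap_le]
  exact le_iSup₂_of_le u ⟨hs, hr⟩ le_rfl

/-- Membership in `σ(X_u : s ≤ u ≤ r)` is membership in the full `σ`-field together with
dependence on the path on `[s, r]` only. -/
theorem measurableSet_sigmaBetween_iff {s r : ℝ≥0} (h : s ≤ r) {A : Set (CadlagPath E)} :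
    MeasurableSet[sigmaBetween s r] A ↔
      MeasurableSet A ∧ ∀ ω, freeze s r ω ∈ A ↔ ω ∈ A := by
  constructor
  · intro hA
    refine ⟨sigmaBetween_le s r _ hA, ?_⟩
    -- the sets that are invariant under freezing form a `σ`-field
    let m : MeasurableSpace (CadlagPath E) :=
      { MeasurableSet' := fun A => ∀ ω, freeze s r ω ∈ A ↔ ω ∈ A
        measurableSet_empty := by simp
        measurableSet_compl := fun A hA ω => by simp [hA ω]
        measurableSet_iUnion := fun f hf ω => by simp [hf _ ω] }
    have hm : sigmaBetween s r ≤ m := by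
      refine iSup₂_le fun u hu => ?_
      rintro _ ⟨B, -, rfl⟩ ω
      simp only [Set.mem_preimage]
      rw [coord_freeze hu.1 hu.2]
    exact hm _ hA
  · rintro ⟨hA, hinv⟩
    have h1 : Measurable[sigmaBetween s r] (freeze (E := E) s r) :=
      measurable_cadlagPath (mα := sigmaBetween s r) fun t =>
        measurable_coord_sigmaBetween (le_max_left _ _) (max_le h (min_le_right _ _))
    have h2 : A = freeze s r ⁻¹' A := Set.ext fun ω => (hinv ω).symm
    rw [h2]
    exact h1 hA

theorem measurableSet_filt_iff {s t : ℝ≥0} (h : s ≤ t) {A : Set (CadlagPath E)} :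
    MeasurableSet[filt s t] A ↔
      MeasurableSet A ∧ ∀ r, t < r → ∀ ω, freeze s r ω ∈ A ↔ ω ∈ A := by
  have h1 : MeasurableSet[filt s t] A ↔ ∀ r, t < r → MeasurableSet[sigmaBetween s r] A := by
    change MeasurableSet[⨅ r : ℝ≥0, ⨅ _ : t < r, sigmaBetween s r] A ↔ _
    simp only [MeasurableSpace.measurableSet_iInf]
  rw [h1]
  constructor
  · intro hA
    refine ⟨sigmaBetween_le _ _ _ (hA (t + 1) (lt_add_of_pos_right t one_pos)), fun r hr => ?_⟩
    exact ((measurableSet_sigmaBetween_iff (h.trans hr.le)).1 (hA r hr)).2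
  · rintro ⟨hA, hinv⟩ r hr
    exact (measurableSet_sigmaBetween_iff (h.trans hr.le)).2 ⟨hA, hinv r hr⟩

theorem measurableSet_coord_filt {s t : ℝ≥0} (h : s ≤ t) (B : Set (Option E)) :
    MeasurableSet[filt s t] (coord t ⁻¹' B) :=
  (measurableSet_filt_iff h).2 ⟨measurable_coord t trivial, fun r hr ω => by
    simp only [Set.mem_preimage]
    rw [coord_freeze h hr.le]⟩

/-- `X` is jointly measurable in time and path. -/
theorem measurable_coord_uncurry [Finite E] :
    Measurable fun p : ℝ≥0 × CadlagPath E => coord p.1 p.2 := by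
  classical
  refine measurable_to_countable' fun x => ?_
  have h := measurable_uncurry_of_rightContinuous
    (f := fun t (ω : CadlagPath E) => if coord t ω = x then (1 : ℝ) else 0)
    (fun t => (measurable_of_countable fun y : Option E => if y = x then (1 : ℝ) else 0).comp
      (measurable_coord t)) fun t ω => ?_
  · convert h (measurableSet_singleton (1 : ℝ)) using 1
    ext p
    by_cases hp : coord p.1 p.2 = x <;> simp [hp]
  · refine tendsto_const_nhds.congr' ?_
    filter_upwards [coord_rightCont ω t] with u hu
    rw [hu]

theorem measurable_shift_uncurry [Finite E] :
    Measurable fun p : ℝ≥0 × CadlagPath E => shift p.1 p.2 :=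
  measurable_cadlagPath fun t => by
    simp only [coord_shift]
    exact measurable_coord_uncurry.comp ((measurable_fst.add_const t).prodMk measurable_snd)

theorem measurable_shift [Finite E] (s : ℝ≥0) : Measurable (shift (E := E) s) :=
  measurable_shift_uncurry.comp measurable_prodMk_left

end

section

variable {E : Type*}

/-! ### Stopping times and the state at a stopping time -/

/-- A stopping time is determined by the path up to any later time (Galmarino's test). -/
theorem stopping_freeze_le_iff {s : ℝ≥0} {τ : CadlagPath E → WithTop ℝ≥0}
    (hτ : IsStoppingTime (filt s) τ) (hs : ∀ ω, (s : WithTop ℝ≥0) ≤ τ ω) {t r : ℝ≥0} (htr : t < r)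
    (ω : CadlagPath E) : τ (freeze s r ω) ≤ t ↔ τ ω ≤ t := by
  by_cases hst : s ≤ t
  · exact ((measurableSet_filt_iff hst).1 (hτ t)).2 r htr ω
  · have h : ∀ ω, ¬ τ ω ≤ t := fun ω h => hst (WithTop.coe_le_coe.1 ((hs ω).trans h))
    exact iff_of_false (h _) (h _)

theorem stopping_freeze_eq {s : ℝ≥0} {τ : CadlagPath E → WithTop ℝ≥0}
    (hτ : IsStoppingTime (filt s) τ) (hs : ∀ ω, (s : WithTop ℝ≥0) ≤ τ ω) {t r : ℝ≥0} (htr : t < r)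
    {ω : CadlagPath E} (h : τ ω ≤ t) : τ (freeze s r ω) = τ ω := by
  have key := fun (u : ℝ≥0) (hu : u < r) => stopping_freeze_le_iff hτ hs hu ω
  have h' := (key t htr).2 h
  obtain ⟨a, ha⟩ := WithTop.ne_top_iff_exists.1 (h.trans_lt (WithTop.coe_lt_top t)).ne
  obtain ⟨b, hb⟩ := WithTop.ne_top_iff_exists.1 (h'.trans_lt (WithTop.coe_lt_top t)).ne
  rw [← ha, WithTop.coe_le_coe] at h
  rw [← hb, WithTop.coe_le_coe] at h'
  refine le_antisymm ?_ ?_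
  · rw [← ha]
    exact (key a (h.trans_lt htr)).2 ha.ge
  · rw [← hb]
    exact (key b (h'.trans_lt htr)).1 hb.ge

theorem measurableSet_stopping_of_ne_top {s : ℝ≥0} {τ : CadlagPath E → WithTop ℝ≥0}
    (hτ : IsStoppingTime (filt s) τ) {A : Set (CadlagPath E)} (hA : ∀ ω ∈ A, τ ω ≠ ⊤)
    (h : ∀ t, MeasurableSet[filt s t] (A ∩ {ω | τ ω ≤ t})) :
    MeasurableSet[hτ.measurableSpace] A := by
  refine ⟨?_, h⟩
  have hU : A = ⋃ n : ℕ, A ∩ {ω | τ ω ≤ ((n : ℝ≥0) : WithTop ℝ≥0)} := by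
    ext ω
    simp only [Set.mem_iUnion, Set.mem_inter_iff, Set.mem_ofPred_eq, exists_and_left, iff_self_and]
    intro hω
    obtain ⟨a, ha⟩ := WithTop.ne_top_iff_exists.1 (hA ω hω)
    obtain ⟨n, hn⟩ := exists_nat_ge a
    exact ⟨n, by rw [← ha]; exact WithTop.coe_le_coe.2 hn⟩
  rw [hU]
  exact MeasurableSet.iUnion fun n => le_iSup (filt s) (n : ℝ≥0) _ (h n)

/-- The state at a stopping time is measurable with respect to the past of the stopping time. -/
theorem measurableSet_coord_stopping [Finite E] {s : ℝ≥0} {τ : CadlagPath E → WithTop ℝ≥0}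
    (hτ : IsStoppingTime (filt s) τ) (hs : ∀ ω, (s : WithTop ℝ≥0) ≤ τ ω) (y : Option E) :
    MeasurableSet[hτ.measurableSpace] {ω | τ ω ≠ ⊤ ∧ coord ((τ ω).untopD 0) ω = y} := by
  refine measurableSet_stopping_of_ne_top hτ (fun ω h => h.1) fun t => ?_
  by_cases hst : s ≤ t
  · rw [measurableSet_filt_iff hst]
    refine ⟨?_, fun r hr ω => ?_⟩
    · refine MeasurableSet.inter (MeasurableSet.inter hτ.measurableSet_eq_top.compl ?_)
        ((filt s).le t _ (hτ t))
      have h : Measurable fun ω : CadlagPath E => coord ((τ ω).untopD 0) ω :=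
        measurable_coord_uncurry.comp ((hτ.measurable'.untopD 0).prodMk measurable_id)
      exact h (measurableSet_singleton y)
    · have hiff := stopping_freeze_le_iff hτ hs hr ω
      simp only [Set.mem_inter_iff, Set.mem_ofPred_eq, hiff]
      refine and_congr_left fun hω => ?_
      rw [stopping_freeze_eq hτ hs hr hω]
      refine and_congr_right fun hne => ?_
      obtain ⟨a, ha⟩ := WithTop.ne_top_iff_exists.1 hne
      have h1 := hs ω
      rw [← ha, WithTop.coe_le_coe] at hω h1
      rw [← ha, WithTop.untopD_coe, coord_freeze h1 (hω.trans hr.le)]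
  · convert @MeasurableSet.empty _ (filt s t) using 1
    refine Set.eq_empty_of_forall_notMem fun ω hω => hst ?_
    exact WithTop.coe_le_coe.1 ((hs ω).trans hω.2)

theorem isStoppingTime_add {s : ℝ≥0} {τ : CadlagPath E → WithTop ℝ≥0}
    (hτ : IsStoppingTime (filt s) τ) (d : ℝ≥0) :
    IsStoppingTime (filt s) fun ω => τ ω + (d : WithTop ℝ≥0) := by
  intro t
  by_cases hdt : d ≤ t
  · have h : {ω | τ ω + (d : WithTop ℝ≥0) ≤ t} = {ω | τ ω ≤ ((t - d : ℝ≥0) : WithTop ℝ≥0)} := by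
      ext ω
      simp only [Set.mem_ofPred_eq]
      cases τ ω with
      | top =>
        rw [WithTop.top_add]
        exact iff_of_false (WithTop.coe_lt_top _).not_ge (WithTop.coe_lt_top _).not_ge
      | coe a => norm_cast; exact (le_tsub_iff_right hdt).symm
    rw [h]
    exact (filt s).mono tsub_le_self _ (hτ (t - d))
  · convert @MeasurableSet.empty _ (filt s t) using 1
    refine Set.eq_empty_of_forall_notMem fun ω hω => hdt ?_
    exact WithTop.coe_le_coe.1 (le_add_self.trans hω)

theorem measurableSet_coord (t : ℝ≥0) (B : Set (Option E)) :
    MeasurableSet {ω : CadlagPath E | coord t ω ∈ B} := measurable_coord t trivial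

/-! ### Cylinder sets -/

/-- The cylinder set of the paths with prescribed values at finitely many times; the times are given
through their successive increments. -/
def cyl : List (ℝ≥0 × Option E) → Set (CadlagPath E)
  | [] => Set.univ
  | (d, y) :: L => {ω | coord d ω = y ∧ shift d ω ∈ cyl L}

theorem measurableSet_cyl [Finite E] (L : List (ℝ≥0 × Option E)) : MeasurableSet (cyl L) := by
  induction L with
  | nil => exact MeasurableSet.univ
  | cons a L ih =>
    exact (measurableSet_coord a.1 {a.2}).inter (measurable_shift a.1 ih)

/-- Prescribing the values of the path on a finite set of times is a cylinder event. Together with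
the converse, this makes the cylinder sets a `π`-system. -/
theorem exists_cyl_eq (S : Finset (ℝ≥0 × Option E)) :
    ∃ L, cyl L = {ω : CadlagPath E | ∀ q ∈ S, coord q.1 ω = q.2} := by
  classical
  have key : ∀ (l : List (ℝ≥0 × Option E)) (b : ℝ≥0), l.Pairwise (fun p q => p.1 ≤ q.1) →
      (∀ q ∈ l, b ≤ q.1) →
      ∃ L, ∀ ω : CadlagPath E, shift b ω ∈ cyl L ↔ ∀ q ∈ l, coord q.1 ω = q.2 := by
    intro l
    induction l with
    | nil => exact fun b _ _ => ⟨[], fun ω => by simp [cyl]⟩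
    | cons a l ih =>
      intro b hl hb
      rw [List.pairwise_cons] at hl
      obtain ⟨L, hL⟩ := ih a.1 hl.2 hl.1
      have hba : b ≤ a.1 := hb a (by simp)
      refine ⟨(a.1 - b, a.2) :: L, fun ω => ?_⟩
      simp only [cyl, Set.mem_ofPred_eq, coord_shift, shift_shift, add_tsub_cancel_of_le hba, hL,
        List.forall_mem_cons]
  have : Std.Total (fun p q : ℝ≥0 × Option E => p.1 ≤ q.1) := ⟨fun p q => le_total _ _⟩
  have : IsTrans (ℝ≥0 × Option E) (fun p q => p.1 ≤ q.1) := ⟨fun p q r => le_trans⟩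
  obtain ⟨L, hL⟩ := key (S.toList.insertionSort fun p q => p.1 ≤ q.1) 0
    (List.pairwise_insertionSort _ _) (fun _ _ => zero_le)
  refine ⟨L, Set.ext fun ω => ?_⟩
  have h0 : shift 0 ω = ω := cadlagPath_ext fun u => by simp
  have := hL ω
  rw [h0] at this
  rw [this]
  simp

theorem cyl_eq_forall (L : List (ℝ≥0 × Option E)) :
    ∃ S : Finset (ℝ≥0 × Option E), cyl L = {ω : CadlagPath E | ∀ q ∈ S, coord q.1 ω = q.2} := by
  classical
  induction L with
  | nil => exact ⟨∅, by simp [cyl]⟩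
  | cons a L ih =>
    obtain ⟨S, hS⟩ := ih
    refine ⟨insert a (S.image fun q => (a.1 + q.1, q.2)), ?_⟩
    ext ω
    simp only [cyl, hS, Set.mem_ofPred_eq, Finset.forall_mem_insert, Finset.forall_mem_image,
      coord_shift]

theorem isPiSystem_cyl : IsPiSystem (Set.range (cyl (E := E))) := by
  classical
  rintro _ ⟨L, rfl⟩ _ ⟨L', rfl⟩ -
  obtain ⟨S, hS⟩ := cyl_eq_forall L
  obtain ⟨S', hS'⟩ := cyl_eq_forall L'
  obtain ⟨L'', h⟩ := exists_cyl_eq (S ∪ S')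
  refine ⟨L'', ?_⟩
  rw [h, hS, hS']
  ext ω
  simp only [Finset.mem_union, Set.mem_ofPred_eq, Set.mem_inter_iff]
  grind

theorem generateFrom_cyl [Finite E] :
    (instMeasurableSpaceCadlagPath : MeasurableSpace (CadlagPath E)) =
      MeasurableSpace.generateFrom (Set.range cyl) := by
  refine le_antisymm (iSup_le fun t => ?_) (MeasurableSpace.generateFrom_le ?_)
  · rintro _ ⟨B, -, rfl⟩
    have h : coord (E := E) t ⁻¹' B = ⋃ y ∈ B, cyl [(t, y)] := by
      ext ω
      simp [cyl]
    rw [h]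
    exact MeasurableSet.biUnion B.to_countable fun y _ =>
      MeasurableSpace.measurableSet_generateFrom ⟨_, rfl⟩
  · rintro _ ⟨L, rfl⟩
    exact measurableSet_cyl L

/-! ### Transition probabilities -/

variable [Fintype E] {Λ : ℝ≥0 → Matrix E E ℝ} (M : StandardMarkovFamily E Λ)

instance StandardMarkovFamily.instIsProbabilityMeasure (s : ℝ≥0) (x : Option E) :
    IsProbabilityMeasure (M.P s x) := M.isProb s x

/-- The probability `P_{t,x}(X_{t+d} = y)`. -/
def transProb (d t : ℝ≥0) (x y : Option E) : ℝ := (M.P t x).real {ω | coord (t + d) ω = y}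

/-- The Markov property in integrated form. -/
theorem markov_real (s : ℝ≥0) (x : Option E) {t r : ℝ≥0} (hst : s ≤ t) (htr : t ≤ r)
    (B : Set (Option E)) {A : Set (CadlagPath E)} (hA : MeasurableSet[filt s t] A) :
    (M.P s x).real ({ω | coord r ω ∈ B} ∩ A) =
      ∫ ω in A, (M.P t (coord t ω)).real {ω' | coord r ω' ∈ B} ∂(M.P s x) := by
  have hB := measurableSet_coord r B
  have hint : Integrable ({ω | coord r ω ∈ B}.indicator fun _ => (1 : ℝ)) (M.P s x) :=
    (integrable_const 1).indicator hB
  have h := setIntegral_condExp ((filt s).le t) hint hA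
  rw [setIntegral_congr_ae ((filt s).le t _ hA)
    ((M.markov s x t r B hst htr).mono fun ω h _ => h)] at h
  rw [h, integral_indicator_const (1 : ℝ) hB]
  simp [measureReal_restrict_apply hB]

theorem transProb_nonneg (d t : ℝ≥0) (x y : Option E) : 0 ≤ transProb M d t x y :=
  measureReal_nonneg

theorem transProb_le_one (d t : ℝ≥0) (x y : Option E) : transProb M d t x y ≤ 1 :=
  measureReal_le_one

theorem tendsto_measureReal_coord (t₀ s : ℝ≥0) (x y : Option E) (d : ℝ≥0) :
    Tendsto (fun t => (M.P s x).real {ω | coord (t + d) ω = y}) (𝓝[>] t₀)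
      (𝓝 ((M.P s x).real {ω | coord (t₀ + d) ω = y})) := by
  have hm : ∀ t, MeasurableSet {ω : CadlagPath E | coord (t + d) ω = y} :=
    fun t => measurableSet_coord (t + d) {y}
  simp_rw [← integral_indicator_one (hm _)]
  refine tendsto_integral_filter_of_dominated_convergence (fun _ => 1)
    (Eventually.of_forall fun t => (measurable_one.indicator (hm t)).aestronglyMeasurable)
    (Eventually.of_forall fun t => Eventually.of_forall fun ω => ?_) (integrable_const _)
    (Eventually.of_forall fun ω => ?_)
  · by_cases h : coord (t + d) ω = y <;> simp [h]
  · refine tendsto_const_nhds.congr' ?_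
    have h1 : Tendsto (fun t => t + d) (𝓝[>] t₀) (𝓝[>] (t₀ + d)) :=
      tendsto_nhdsWithin_iff.2
        ⟨((continuous_id.add continuous_const).tendsto t₀).mono_left nhdsWithin_le_nhds,
          eventually_nhdsWithin_of_forall fun u hu => add_lt_add_left (Set.mem_Ioi.1 hu) d⟩
    filter_upwards [h1.eventually (coord_rightCont ω (t₀ + d))] with t ht
    by_cases h : coord (t₀ + d) ω = y <;> simp [h, ht]

/-- The transition probabilities are right-continuous in the starting time: by the Markov property
the chain started at `t` is, up to the small probability of having moved, the chain started at a
slightly later time. -/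
theorem tendsto_transProb (d t₀ : ℝ≥0) (x y : Option E) :
    Tendsto (fun t => transProb M d t x y) (𝓝[>] t₀) (𝓝 (transProb M d t₀ x y)) := by
  have h1 := tendsto_measureReal_coord M t₀ t₀ x y d
  have h2 := tendsto_measureReal_coord M t₀ t₀ x x 0
  simp only [add_zero] at h2
  have h3 : (M.P t₀ x).real {ω | coord t₀ ω = x} = 1 := by
    have h : (M.P t₀ x) {ω | coord t₀ ω = x} = 1 :=
      (prob_compl_eq_zero_iff (measurableSet_coord t₀ {x})).1 (M.start t₀ x)
    rw [measureReal_def, h]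
    simp
  rw [h3] at h2
  have h4 : ∀ t, t₀ ≤ t → |transProb M d t x y - (M.P t₀ x).real {ω | coord (t + d) ω = y}| ≤
      1 - (M.P t₀ x).real {ω | coord t ω = x} := by
    intro t ht
    have hmk := markov_real M t₀ x ht (le_self_add (b := d)) {y} (A := Set.univ)
      (@MeasurableSet.univ _ (filt t₀ t))
    simp only [Set.mem_singleton_iff, Set.inter_univ, Measure.restrict_univ] at hmk
    have hmeas : Measurable fun ω : CadlagPath E => transProb M d t (coord t ω) y :=
      (measurable_of_countable fun z => transProb M d t z y).comp (measurable_coord t)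
    have hint : Integrable (fun ω : CadlagPath E => transProb M d t (coord t ω) y) (M.P t₀ x) :=
      Integrable.of_bound hmeas.aestronglyMeasurable 1 (Eventually.of_forall fun ω => by
        rw [Real.norm_of_nonneg (transProb_nonneg ..)]; exact transProb_le_one ..)
    have hx := measurableSet_coord (E := E) t {x}
    have h5 : transProb M d t x y - (M.P t₀ x).real {ω | coord (t + d) ω = y} =
        ∫ ω, (transProb M d t x y - transProb M d t (coord t ω) y) ∂(M.P t₀ x) := by
      rw [integral_sub (integrable_const _) hint, hmk]
      simp [transProb]
    have h6 : 1 - (M.P t₀ x).real {ω | coord t ω = x} =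
        ∫ ω, {ω | coord t ω ∈ ({x} : Set (Option E))}ᶜ.indicator 1 ω ∂(M.P t₀ x) := by
      rw [integral_indicator_one hx.compl, probReal_compl_eq_one_sub hx]
      rfl
    rw [h5, h6]
    refine (abs_integral_le_integral_abs).trans (integral_mono ((integrable_const _).sub hint).abs
      ((integrable_const (1 : ℝ)).indicator hx.compl) fun ω => ?_)
    by_cases h : coord t ω = x
    · simp [h]
    · simp only [Set.mem_singleton_iff, Set.mem_compl_iff, Set.mem_ofPred_eq, h, not_false_eq_true,
        Set.indicator_of_mem, Pi.one_apply]
      have a1 := transProb_nonneg M d t x y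
      have a2 := transProb_le_one M d t x y
      have a3 := transProb_nonneg M d t (coord t ω) y
      have a4 := transProb_le_one M d t (coord t ω) y
      exact abs_le.2 ⟨by linarith, by linarith⟩
  have h5 : Tendsto (fun t => transProb M d t x y - (M.P t₀ x).real {ω | coord (t + d) ω = y})
      (𝓝[>] t₀) (𝓝 0) := by
    refine squeeze_zero_norm' (a := fun t => 1 - (M.P t₀ x).real {ω | coord t ω = x}) ?_ ?_
    · exact eventually_nhdsWithin_of_forall fun t ht => h4 t (le_of_lt ht)
    · simpa using h2.const_sub 1
  simpa [transProb] using h5.add h1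

theorem measurable_transProb (d : ℝ≥0) (x y : Option E) : Measurable fun t => transProb M d t x y :=
  (measurable_uncurry_of_rightContinuous (Ω := Unit) (f := fun t _ => transProb M d t x y)
    (fun _ => measurable_const) fun t _ => tendsto_transProb M d t x y).comp
    (measurable_id.prodMk (measurable_const (a := ())))

/-- The probability of a cylinder set for the chain started in `x` at time `t`, with times counted
from `t`, as a product of transition probabilities. -/
def cylProb : List (ℝ≥0 × Option E) → ℝ≥0 → Option E → ℝ
  | [], _, _ => 1
  | (d, y) :: L, t, x => transProb M d t x y * cylProb L (t + d) y

theorem cylProb_mem (L : List (ℝ≥0 × Option E)) (t : ℝ≥0) (x : Option E) :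
    0 ≤ cylProb M L t x ∧ cylProb M L t x ≤ 1 := by
  induction L generalizing t x with
  | nil => simp [cylProb]
  | cons a L ih =>
    have h := ih (t + a.1) a.2
    exact ⟨mul_nonneg (transProb_nonneg ..) h.1, mul_le_one₀ (transProb_le_one ..) h.1 h.2⟩

theorem measurable_cylProb (L : List (ℝ≥0 × Option E)) (x : Option E) :
    Measurable fun t => cylProb M L t x := by
  induction L generalizing x with
  | nil => exact measurable_const
  | cons a L ih =>
    exact (measurable_transProb M a.1 x a.2).mul ((ih a.2).comp (measurable_id.add_const a.1))

end

section

variable {E : Type*} [Fintype E] {Λ : ℝ≥0 → Matrix E E ℝ} (M : StandardMarkovFamily E Λ)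

/-! ### The strong Markov property for functionals of the whole future -/

theorem coordTop_of_ne_top {E : Type*} {ω : CadlagPath E} {t : WithTop ℝ≥0} (h : t ≠ ⊤) :
    coordTop ω t = coord (t.untopD 0) ω := by
  obtain ⟨a, rfl⟩ := WithTop.ne_top_iff_exists.1 h
  rfl

theorem measurable_coord_untopD {E : Type*} [Finite E] {τ : CadlagPath E → WithTop ℝ≥0}
    (hτ : Measurable τ) (d : ℝ≥0) :
    Measurable fun ω : CadlagPath E => coord ((τ ω).untopD 0 + d) ω :=
  measurable_coord_uncurry.comp (((hτ.untopD 0).add_const d).prodMk measurable_id)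

theorem strongMarkov_step (s : ℝ≥0) (x : Option E) {τ : CadlagPath E → WithTop ℝ≥0}
    (hτ : IsStoppingTime (filt s) τ) (hs : ∀ ω, (s : WithTop ℝ≥0) ≤ τ ω) {W : CadlagPath E → ℝ}
    (hW : StronglyMeasurable[hτ.measurableSpace] W) (hb : ∀ ω, |W ω| ≤ 1) (d : ℝ≥0)
    (y : Option E) :
    ∫ ω in {ω | τ ω ≠ ⊤ ∧ coord ((τ ω).untopD 0 + d) ω = y}, W ω ∂(M.P s x) =
      ∫ ω in {ω | τ ω ≠ ⊤},
        W ω * transProb M d ((τ ω).untopD 0) (coord ((τ ω).untopD 0) ω) y ∂(M.P s x) := by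
  have hT : MeasurableSet {ω | τ ω ≠ ⊤} := hτ.measurableSet_eq_top.compl
  have hA : MeasurableSet {ω | τ ω ≠ ⊤ ∧ coord ((τ ω).untopD 0 + d) ω = y} :=
    hT.inter (measurable_coord_untopD hτ.measurable' d (measurableSet_singleton y))
  have hint : Integrable
      ({ω | τ ω ≠ ⊤ ∧ coord ((τ ω).untopD 0 + d) ω = y}.indicator fun _ => (1 : ℝ)) (M.P s x) :=
    (integrable_const 1).indicator hA
  have h1 := condExp_stronglyMeasurable_mul_of_bound hτ.measurableSpace_le hW hint 1
    (Eventually.of_forall fun ω => hb ω)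
  have h2 := M.strongMarkov s x τ hτ hs d {y}
  simp only [Set.mem_singleton_iff] at h2
  rw [← integral_indicator hA, ← integral_indicator hT]
  calc _ = ∫ ω, (W * {ω | τ ω ≠ ⊤ ∧ coord ((τ ω).untopD 0 + d) ω = y}.indicator
        fun _ => (1 : ℝ)) ω ∂(M.P s x) := by
        refine integral_congr_ae (Eventually.of_forall fun ω => ?_)
        by_cases h : τ ω ≠ ⊤ ∧ coord ((τ ω).untopD 0 + d) ω = y <;> simp [h]
    _ = _ := by
        rw [← integral_condExp hτ.measurableSpace_le]
        refine integral_congr_ae (h1.trans ?_)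
        filter_upwards [h2] with ω hω
        rw [Pi.mul_apply, hω]
        by_cases h : τ ω ≠ ⊤
        · simp [h, coordTop_of_ne_top h, transProb]
        · simp [h]

/-- The strong Markov property for cylinder sets of the future, weighted by a random variable from
the past. The first coordinate of the cylinder is absorbed into the past of the stopping time
`τ + d`. -/
theorem strongMarkov_cyl (s : ℝ≥0) (x : Option E) (L : List (ℝ≥0 × Option E))
    {τ : CadlagPath E → WithTop ℝ≥0}
    (hτ : IsStoppingTime (filt s) τ) (hs : ∀ ω, (s : WithTop ℝ≥0) ≤ τ ω) {W : CadlagPath E → ℝ}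
    (hW : StronglyMeasurable[hτ.measurableSpace] W) (hb : ∀ ω, |W ω| ≤ 1) :
    ∫ ω in {ω | τ ω ≠ ⊤ ∧ shift ((τ ω).untopD 0) ω ∈ cyl L}, W ω ∂(M.P s x) =
      ∫ ω in {ω | τ ω ≠ ⊤},
        W ω * cylProb M L ((τ ω).untopD 0) (coord ((τ ω).untopD 0) ω) ∂(M.P s x) := by
  induction L generalizing τ W with
  | nil => simp [cyl, cylProb]
  | cons a L ih =>
    obtain ⟨d, y⟩ := a
    have hπ := isStoppingTime_add hτ d
    have hπs : ∀ ω, (s : WithTop ℝ≥0) ≤ τ ω + (d : WithTop ℝ≥0) := fun ω =>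
      (hs ω).trans le_self_add
    have htop : ∀ ω, τ ω + (d : WithTop ℝ≥0) ≠ ⊤ ↔ τ ω ≠ ⊤ := fun ω => by
      cases τ ω with
      | top => simp only [WithTop.top_add]
      | coe a => exact iff_of_true (WithTop.coe_ne_top (a := a + d)) WithTop.coe_ne_top
    have hunt : ∀ ω, τ ω ≠ ⊤ →
        (τ ω + (d : WithTop ℝ≥0)).untopD 0 = (τ ω).untopD 0 + d := fun ω h => by
      obtain ⟨a, ha⟩ := WithTop.ne_top_iff_exists.1 h
      rw [← ha]
      rfl
    have hB' := measurableSet_coord_stopping hπ hπs y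
    have hBeq : {ω : CadlagPath E | τ ω + (d : WithTop ℝ≥0) ≠ ⊤ ∧
        coord ((τ ω + (d : WithTop ℝ≥0)).untopD 0) ω = y} =
        {ω | τ ω ≠ ⊤ ∧ coord ((τ ω).untopD 0 + d) ω = y} := by
      ext ω
      simp only [Set.mem_ofPred_eq, htop]
      refine and_congr_right fun h => ?_
      rw [hunt ω h]
    rw [hBeq] at hB'
    set B := {ω : CadlagPath E | τ ω ≠ ⊤ ∧ coord ((τ ω).untopD 0 + d) ω = y} with hBdef
    have hBm : MeasurableSet B := hπ.measurableSpace_le _ hB'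
    have hle := hτ.measurableSpace_mono hπ fun ω => le_self_add
    have hW' : StronglyMeasurable[hπ.measurableSpace] (B.indicator W) :=
      (hW.mono hle).indicator hB'
    have hIH := ih hπ hπs hW' fun ω => by
      by_cases h : ω ∈ B
      · simpa [h] using hb ω
      · simp [h]
    have hmL := measurable_cylProb M L y
    have hW'' : StronglyMeasurable[hτ.measurableSpace]
        fun ω => W ω * cylProb M L ((τ ω).untopD 0 + d) y := by
      refine hW.mul (Measurable.stronglyMeasurable ?_)
      exact hmL.comp ((hτ.measurable.untopD 0).add_const d)
    have hstep := strongMarkov_step M s x hτ hs hW'' (fun ω => by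
      rw [abs_mul, abs_of_nonneg (cylProb_mem M L _ _).1]
      exact mul_le_one₀ (hb ω) (cylProb_mem M L _ _).1 (cylProb_mem M L _ _).2) d y
    rw [setIntegral_indicator hBm] at hIH
    have hset : {ω | τ ω + (d : WithTop ℝ≥0) ≠ ⊤ ∧
        shift ((τ ω + (d : WithTop ℝ≥0)).untopD 0) ω ∈ cyl L} ∩ B =
        {ω | τ ω ≠ ⊤ ∧ shift ((τ ω).untopD 0) ω ∈ cyl ((d, y) :: L)} := by
      ext ω
      simp only [hBdef, cyl, Set.mem_inter_iff, Set.mem_ofPred_eq, htop, coord_shift, shift_shift]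
      constructor
      · rintro ⟨⟨h1, h2⟩, -, h3⟩
        rw [hunt ω h1] at h2
        exact ⟨h1, h3, h2⟩
      · rintro ⟨h1, h3, h2⟩
        rw [hunt ω h1]
        exact ⟨⟨h1, h2⟩, h1, h3⟩
    rw [hset] at hIH
    rw [hIH]
    have hT : MeasurableSet {ω | τ ω ≠ ⊤} := hτ.measurableSet_eq_top.compl
    calc _ = ∫ ω in B, W ω * cylProb M L ((τ ω).untopD 0 + d) y ∂(M.P s x) := by
          simp only [htop]
          rw [← integral_indicator hT, ← integral_indicator hBm]
          refine integral_congr_ae (Eventually.of_forall fun ω => ?_)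
          by_cases h : ω ∈ B
          · have h1 : τ ω ≠ ⊤ := h.1
            have h2 : coord ((τ ω).untopD 0 + d) ω = y := h.2
            rw [Set.indicator_of_mem (show ω ∈ {ω | τ ω ≠ ⊤} from h1), Set.indicator_of_mem h,
              Set.indicator_of_mem h, hunt ω h1, h2]
          · by_cases h1 : τ ω ≠ ⊤ <;> simp [h, h1]
      _ = _ := by
          rw [hstep]
          refine setIntegral_congr_fun hT fun ω _ => ?_
          simp only [cylProb]
          ring

theorem map_shift_cyl (t : ℝ≥0) (x : Option E) (L : List (ℝ≥0 × Option E)) :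
    ((M.P t x).map (shift t)) (cyl L) = ENNReal.ofReal (cylProb M L t x) := by
  have h := strongMarkov_cyl M t x L (isStoppingTime_const (filt t) t) (fun _ => le_rfl)
    (W := fun _ => 1) stronglyMeasurable_const (fun _ => by simp)
  rw [Measure.map_apply (measurable_shift t) (measurableSet_cyl L),
    ← ENNReal.ofReal_toReal (measure_ne_top (M.P t x) _)]
  congr 1
  have h1 : ∀ t : ℝ≥0, (t : WithTop ℝ≥0) ≠ ⊤ := fun t => WithTop.coe_ne_top
  simp only [ne_eq, h1, not_false_eq_true, true_and, WithTop.untopD_coe, integral_const,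
    measureReal_restrict_apply_univ, smul_eq_mul, mul_one, one_mul, Set.ofPred_true,
    Measure.restrict_univ] at h
  refine h.trans ?_
  have h2 : (fun ω => cylProb M L t (coord t ω)) =ᵐ[M.P t x] fun _ => cylProb M L t x := by
    filter_upwards [M.start t x] with ω hω
    rw [hω]
  rw [integral_congr_ae h2]
  simp

/-- The law of the shifted path `u ↦ X_{t+u}` under `P_{t,x}`, as a kernel in `(t, x)`. -/
def shiftKernel : Kernel (ℝ≥0 × Option E) (CadlagPath E) where
  toFun p := (M.P p.1 p.2).map (shift p.1)
  measurable' := by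
    have : ∀ p : ℝ≥0 × Option E, IsProbabilityMeasure ((M.P p.1 p.2).map (shift p.1)) := fun p =>
      Measure.isProbabilityMeasure_map (measurable_shift p.1).aemeasurable
    refine Measurable.measure_of_isPiSystem_of_isProbabilityMeasure generateFrom_cyl
      isPiSystem_cyl ?_
    rintro _ ⟨L, rfl⟩
    simp only [map_shift_cyl]
    exact ENNReal.measurable_ofReal.comp
      (measurable_from_prod_countable_left fun x => measurable_cylProb M L x)

theorem shiftKernel_apply (p : ℝ≥0 × Option E) :
    shiftKernel M p = (M.P p.1 p.2).map (shift p.1) := rfl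

instance : IsMarkovKernel (shiftKernel M) :=
  ⟨fun p => Measure.isProbabilityMeasure_map (measurable_shift p.1).aemeasurable⟩

theorem integral_shiftKernel (t : ℝ≥0) (x : Option E) {F : CadlagPath E → ℝ} (hF : Measurable F) :
    ∫ ω, F ω ∂(shiftKernel M (t, x)) = ∫ ω, F (shift t ω) ∂(M.P t x) :=
  integral_map (measurable_shift t).aemeasurable hF.aestronglyMeasurable

/-- The joint law of a stopping time and the future path after it. -/
theorem map_stopping_shift (s : ℝ≥0) (x : Option E) {τ : CadlagPath E → WithTop ℝ≥0}
    (hτ : IsStoppingTime (filt s) τ) (hs : ∀ ω, (s : WithTop ℝ≥0) ≤ τ ω) :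
    ((M.P s x).restrict {ω | τ ω ≠ ⊤}).map
        (fun ω => ((τ ω).untopD 0, shift ((τ ω).untopD 0) ω)) =
      ((((M.P s x).restrict {ω | τ ω ≠ ⊤}).map
        (fun ω => ((τ ω).untopD 0, coord ((τ ω).untopD 0) ω))) ⊗ₘ shiftKernel M).map
          (fun p => (p.1.1, p.2)) := by
  have hT : MeasurableSet {ω | τ ω ≠ ⊤} := hτ.measurableSet_eq_top.compl
  have hσ : Measurable fun ω => (τ ω).untopD 0 := hτ.measurable'.untopD 0
  have hsh : Measurable fun ω => shift ((τ ω).untopD 0) ω :=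
    measurable_shift_uncurry.comp (hσ.prodMk measurable_id)
  have hco : Measurable fun ω : CadlagPath E => coord ((τ ω).untopD 0) ω :=
    measurable_coord_uncurry.comp (hσ.prodMk measurable_id)
  have hpair := hσ.prodMk hco
  have hproj : Measurable fun p : (ℝ≥0 × Option E) × CadlagPath E => (p.1.1, p.2) := by fun_prop
  have : IsProbabilityMeasure (M.P s x) := M.isProb s x
  have key : ∀ (A : Set ℝ≥0) (L : List (ℝ≥0 × Option E)), MeasurableSet A →
      ((M.P s x).restrict {ω | τ ω ≠ ⊤}).map
        (fun ω => ((τ ω).untopD 0, shift ((τ ω).untopD 0) ω)) (A ×ˢ cyl L) =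
      ((((M.P s x).restrict {ω | τ ω ≠ ⊤}).map
        (fun ω => ((τ ω).untopD 0, coord ((τ ω).untopD 0) ω))) ⊗ₘ shiftKernel M).map
          (fun p => (p.1.1, p.2)) (A ×ˢ cyl L) := by
    intro A L hA
    have hcyl := measurableSet_cyl (E := E) L
    have h0 : (fun p : (ℝ≥0 × Option E) × CadlagPath E => (p.1.1, p.2)) ⁻¹' (A ×ˢ cyl L) =
        (A ×ˢ Set.univ) ×ˢ cyl L := by
      ext p
      simp
    rw [Measure.map_apply (hσ.prodMk hsh) (hA.prod hcyl),
      Measure.map_apply hproj (hA.prod hcyl), h0,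
      Measure.compProd_apply_prod (hA.prod MeasurableSet.univ) hcyl,
      ← lintegral_indicator (hA.prod MeasurableSet.univ), lintegral_map ?_ hpair]
    swap
    · exact ((shiftKernel M).measurable_coe hcyl).indicator (hA.prod MeasurableSet.univ)
    have hW : StronglyMeasurable[hτ.measurableSpace]
        (((fun ω => (τ ω).untopD 0) ⁻¹' A).indicator fun _ => (1 : ℝ)) :=
      stronglyMeasurable_const.indicator ((hτ.measurable.untopD 0) hA)
    have h1 := strongMarkov_cyl M s x L hτ hs hW fun ω => by
      by_cases h : (τ ω).untopD 0 ∈ A <;> simp [h]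
    have hmc : Measurable fun ω => cylProb M L ((τ ω).untopD 0) (coord ((τ ω).untopD 0) ω) :=
      (measurable_from_prod_countable_left (f := fun p : ℝ≥0 × Option E => cylProb M L p.1 p.2)
        fun y => measurable_cylProb M L y).comp hpair
    have h2 : ∀ ω, (A ×ˢ (Set.univ : Set (Option E))).indicator
        (fun a => (shiftKernel M a) (cyl L)) ((τ ω).untopD 0, coord ((τ ω).untopD 0) ω) =
        ENNReal.ofReal ((((fun ω => (τ ω).untopD 0) ⁻¹' A).indicator fun _ => (1 : ℝ)) ω *
          cylProb M L ((τ ω).untopD 0) (coord ((τ ω).untopD 0) ω)) := by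
      intro ω
      by_cases h : (τ ω).untopD 0 ∈ A
      · simp [h, shiftKernel_apply, map_shift_cyl]
      · simp [h]
    simp_rw [h2]
    rw [← ofReal_integral_eq_lintegral_ofReal, ← h1,
      integral_indicator_const _ (hσ hA)]
    · rw [smul_eq_mul, mul_one, measureReal_def, ENNReal.ofReal_toReal (measure_ne_top _ _),
        Measure.restrict_apply (hσ hA), Measure.restrict_apply ((hσ.prodMk hsh) (hA.prod hcyl))]
      congr 1
      ext ω
      simp only [Set.mem_inter_iff, Set.mem_preimage, Set.mem_prod, Set.mem_ofPred_eq]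
      tauto
    · refine Integrable.of_bound ((measurable_const.indicator (hσ hA)).mul
        hmc).aestronglyMeasurable 1 (Eventually.of_forall fun ω => ?_)
      have := cylProb_mem M L ((τ ω).untopD 0) (coord ((τ ω).untopD 0) ω)
      by_cases h : (τ ω).untopD 0 ∈ A
      · simp [h, abs_of_nonneg this.1, this.2]
      · simp [h]
    · refine Eventually.of_forall fun ω => ?_
      have := cylProb_mem M L ((τ ω).untopD 0) (coord ((τ ω).untopD 0) ω)
      exact mul_nonneg (Set.indicator_nonneg (fun _ _ => zero_le_one) _) this.1
  refine ext_of_generate_finite (Set.image2 (· ×ˢ ·) {A | MeasurableSet A} (Set.range cyl))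
    (generateFrom_eq_prod MeasurableSpace.generateFrom_measurableSet generateFrom_cyl.symm
      isCountablySpanning_measurableSet ⟨fun _ => Set.univ, fun _ => ⟨[], rfl⟩,
        Set.iUnion_const _⟩).symm
    (MeasurableSpace.isPiSystem_measurableSet.prod isPiSystem_cyl) ?_ ?_
  · rintro _ ⟨A, hA, _, ⟨L, rfl⟩, rfl⟩
    exact key A L hA
  · have h := key Set.univ [] MeasurableSet.univ
    simpa only [cyl, Set.univ_prod_univ] using h

/-- The strong Markov property for bounded functionals of a stopping time and the path after it. -/
theorem strongMarkov_integral (s : ℝ≥0) (x : Option E) {τ : CadlagPath E → WithTop ℝ≥0}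
    (hτ : IsStoppingTime (filt s) τ) (hs : ∀ ω, (s : WithTop ℝ≥0) ≤ τ ω)
    {F : ℝ≥0 × CadlagPath E → ℝ} (hF : Measurable F) {C : ℝ} (hC : ∀ p, |F p| ≤ C) :
    ∫ ω in {ω | τ ω ≠ ⊤}, F ((τ ω).untopD 0, shift ((τ ω).untopD 0) ω) ∂(M.P s x) =
      ∫ ω in {ω | τ ω ≠ ⊤}, ∫ ω', F ((τ ω).untopD 0, shift ((τ ω).untopD 0) ω')
        ∂(M.P ((τ ω).untopD 0) (coord ((τ ω).untopD 0) ω)) ∂(M.P s x) := by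
  have hσ : Measurable fun ω => (τ ω).untopD 0 := hτ.measurable'.untopD 0
  have hsh : Measurable fun ω => shift ((τ ω).untopD 0) ω :=
    measurable_shift_uncurry.comp (hσ.prodMk measurable_id)
  have hco : Measurable fun ω : CadlagPath E => coord ((τ ω).untopD 0) ω :=
    measurable_coord_uncurry.comp (hσ.prodMk measurable_id)
  have hproj : Measurable fun p : (ℝ≥0 × Option E) × CadlagPath E => (p.1.1, p.2) := by fun_prop
  have h1 := integral_map (μ := (M.P s x).restrict {ω | τ ω ≠ ⊤}) (hσ.prodMk hsh).aemeasurable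
    hF.aestronglyMeasurable
  rw [← h1, map_stopping_shift M s x hτ hs, integral_map hproj.aemeasurable
    hF.aestronglyMeasurable, Measure.integral_compProd, integral_map (hσ.prodMk hco).aemeasurable]
  · refine integral_congr_ae (Eventually.of_forall fun ω => ?_)
    exact integral_shiftKernel M _ _ (hF.comp measurable_prodMk_left)
  · exact ((hF.comp hproj).stronglyMeasurable.integral_kernel_prod_right').aestronglyMeasurable
  · exact Integrable.of_bound (hF.comp hproj).aestronglyMeasurable C
      (Eventually.of_forall fun p => hC _)

end

/-! ### The additive functional along a path -/

section Paths

variable {E : Type*} (v : E → ℝ)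

theorem measurable_velocity [Finite E] :
    Measurable fun p : ℝ × CadlagPath E => extCoffin v (coord p.1.toNNReal p.2) :=
  (measurable_of_countable (extCoffin v)).comp (measurable_coord_uncurry.comp
    ((measurable_real_toNNReal.comp measurable_fst).prodMk measurable_snd))

theorem exists_velocity_bound [Finite E] : ∃ B : ℝ, ∀ x, |extCoffin v x| ≤ B := by
  obtain ⟨B, hB⟩ := (Set.finite_range fun x => |extCoffin v x|).bddAbove
  exact ⟨B, fun x => hB ⟨x, rfl⟩⟩

theorem intervalIntegrable_velocity [Finite E] (ω : CadlagPath E) (a b : ℝ) :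
    IntervalIntegrable (fun u : ℝ => extCoffin v (coord u.toNNReal ω)) volume a b := by
  obtain ⟨B, hB⟩ := exists_velocity_bound v
  refine intervalIntegrable_const (c := B) |>.mono_fun ?_ ?_
  · exact ((measurable_velocity v).comp measurable_prodMk_right).aestronglyMeasurable
  · refine Eventually.of_forall fun u => ?_
    exact (hB _).trans (le_abs_self B)

theorem phi_coe (s : ℝ≥0) (ω : CadlagPath E) (t : ℝ≥0) : phi v s ω (t : WithTop ℝ≥0) =
    ∫ u in (s : ℝ)..(t : ℝ), extCoffin v (coord u.toNNReal ω) := rfl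

theorem phi_self (s : ℝ≥0) (ω : CadlagPath E) : phi v s ω (s : WithTop ℝ≥0) = 0 := by
  simp only [phi_coe, intervalIntegral.integral_same]

theorem phi_add [Finite E] (s σ u : ℝ≥0) (ω : CadlagPath E) :
    phi v s ω (u : WithTop ℝ≥0) = phi v s ω (σ : WithTop ℝ≥0) + phi v σ ω (u : WithTop ℝ≥0) := by
  simp only [phi_coe]
  exact (intervalIntegral.integral_add_adjacent_intervals (intervalIntegrable_velocity v ω _ _)
    (intervalIntegrable_velocity v ω _ _)).symm

theorem continuous_phi [Finite E] (s : ℝ≥0) (ω : CadlagPath E) :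
    Continuous fun t : ℝ≥0 => phi v s ω (t : WithTop ℝ≥0) := by
  simp only [phi_coe]
  exact (intervalIntegral.continuous_primitive (intervalIntegrable_velocity v ω) _).comp
    NNReal.continuous_coe

theorem phi_of_const {a b : ℝ≥0} (hab : a ≤ b) {ω : CadlagPath E} {x : Option E}
    (h : ∀ u, a < u → u < b → coord u ω = x) :
    phi v a ω (b : WithTop ℝ≥0) = ((b : ℝ) - a) * extCoffin v x := by
  rw [phi_coe, intervalIntegral.integral_of_le (NNReal.coe_le_coe.2 hab),
    integral_Ioc_eq_integral_Ioo]
  have h1 : ∀ u ∈ Set.Ioo (a : ℝ) b, extCoffin v (coord u.toNNReal ω) = extCoffin v x := by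
    intro u hu
    rw [h]
    · exact Real.lt_toNNReal_iff_coe_lt.2 hu.1
    · exact (Real.toNNReal_lt_iff_lt_coe (a.2.trans hu.1.le)).2 hu.2
  rw [setIntegral_congr_fun measurableSet_Ioo h1]
  simp [hab]

theorem phi_neg (s : ℝ≥0) (ω : CadlagPath E) (t : WithTop ℝ≥0) :
    phi (-v) s ω t = -phi v s ω t := by
  have h : ∀ x, extCoffin (-v) x = -extCoffin v x := by
    rintro (_ | i) <;> simp [extCoffin]
  cases t with
  | top => simp [phi]
  | coe t => simp only [phi_coe, h, intervalIntegral.integral_neg]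

theorem phi_freeze {s r u : ℝ≥0} (hs : s ≤ u) (hr : u ≤ r) (ω : CadlagPath E) :
    phi v s (freeze s r ω) (u : WithTop ℝ≥0) = phi v s ω (u : WithTop ℝ≥0) := by
  simp only [phi_coe]
  refine intervalIntegral.integral_congr fun w hw => ?_
  rw [Set.uIcc_of_le (NNReal.coe_le_coe.2 hs)] at hw
  rw [coord_freeze]
  · exact NNReal.le_toNNReal_of_coe_le hw.1
  · exact (Real.toNNReal_le_iff_le_coe.2 hw.2).trans hr

theorem phi_shift (s u : ℝ≥0) (ω : CadlagPath E) :
    phi v s ω ((s + u : ℝ≥0) : WithTop ℝ≥0) = phi v 0 (shift s ω) (u : WithTop ℝ≥0) := by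
  have h := intervalIntegral.integral_comp_add_left
    (fun w => extCoffin v (coord w.toNNReal ω)) (a := 0) (b := u) (s : ℝ)
  rw [phi_coe, phi_coe, NNReal.coe_add, NNReal.coe_zero]
  rw [add_zero] at h
  rw [← h]
  refine intervalIntegral.integral_congr fun w hw => ?_
  rw [Set.uIcc_of_le (NNReal.coe_nonneg u)] at hw
  simp only [coord_shift]
  rw [Real.toNNReal_add (NNReal.coe_nonneg s) hw.1, Real.toNNReal_coe]

theorem measurable_phi [Finite E] (t : ℝ≥0) :
    Measurable fun ω : CadlagPath E => phi v 0 ω (t : WithTop ℝ≥0) := by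
  simp only [phi_coe]
  have h := (measurable_velocity v).comp (measurable_swap (α := CadlagPath E) (β := ℝ))
  simp only [intervalIntegral.integral_of_le (NNReal.coe_le_coe.2 (zero_le : 0 ≤ t))]
  exact (h.stronglyMeasurable.integral_prod_right' (ν := volume.restrict (Set.Ioc _ _))).measurable

/-! ### First passage times -/

variable {v}

theorem tauPlus_lt_iff {ℓ s : ℝ≥0} {ω : CadlagPath E} {a : WithTop ℝ≥0} :
    tauPlus v ℓ s ω < a ↔
      ∃ t : ℝ≥0, s ≤ t ∧ (t : WithTop ℝ≥0) < a ∧ (ℓ : ℝ) < phi v s ω (t : WithTop ℝ≥0) := by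
  rw [tauPlus, sInf_lt_iff]
  constructor
  · rintro ⟨t, ⟨h1, h2⟩, h3⟩
    obtain ⟨b, rfl⟩ := WithTop.ne_top_iff_exists.1 (h3.trans_le le_top).ne
    exact ⟨b, WithTop.coe_le_coe.1 h1, h3, h2⟩
  · rintro ⟨t, h1, h2, h3⟩
    exact ⟨t, ⟨WithTop.coe_le_coe.2 h1, h3⟩, h2⟩

theorem le_tauPlus (ℓ s : ℝ≥0) (ω : CadlagPath E) : (s : WithTop ℝ≥0) ≤ tauPlus v ℓ s ω :=
  le_sInf fun _ h => h.1

theorem phi_le_of_lt_tauPlus {ℓ s t : ℝ≥0} {ω : CadlagPath E} (hs : s ≤ t)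
    (h : (t : WithTop ℝ≥0) < tauPlus v ℓ s ω) : phi v s ω (t : WithTop ℝ≥0) ≤ ℓ := by
  by_contra! hlt
  exact h.not_ge (sInf_le ⟨WithTop.coe_le_coe.2 hs, hlt⟩)

theorem phi_le_of_le_tauPlus [Finite E] {ℓ s t : ℝ≥0} {ω : CadlagPath E} (hs : s ≤ t)
    (h : (t : WithTop ℝ≥0) ≤ tauPlus v ℓ s ω) : phi v s ω (t : WithTop ℝ≥0) ≤ ℓ := by
  rcases hs.eq_or_lt with rfl | hlt
  · rw [phi_self]
    exact ℓ.2
  · -- the value at `t` is the limit of the values to the left of `t`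
    have : (𝓝[<] t).NeBot := nhdsLT_neBot_of_exists_lt ⟨s, hlt⟩
    refine le_of_tendsto (((continuous_phi v s ω).tendsto t).mono_left
      (nhdsWithin_le_nhds (s := Set.Iio t))) ?_
    filter_upwards [Ioo_mem_nhdsLT hlt] with u hu
    exact phi_le_of_lt_tauPlus hu.1.le ((WithTop.coe_lt_coe.2 hu.2).trans_le h)

theorem phi_tauPlus [Finite E] {ℓ s a : ℝ≥0} {ω : CadlagPath E} (ha : tauPlus v ℓ s ω = a) :
    phi v s ω (a : WithTop ℝ≥0) = ℓ := by
  have hsa : s ≤ a := WithTop.coe_le_coe.1 (ha ▸ le_tauPlus ℓ s ω)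
  refine le_antisymm (phi_le_of_le_tauPlus hsa ha.ge) ?_
  by_contra! hlt
  have h1 : ∀ᶠ u : ℝ≥0 in 𝓝 a, phi v s ω (u : WithTop ℝ≥0) < ℓ :=
    (continuous_phi v s ω).continuousAt.eventually (gt_mem_nhds hlt)
  obtain ⟨b, hb, hab⟩ := exists_Ico_subset_of_mem_nhds h1 ⟨a + 1, lt_add_of_pos_right a one_pos⟩
  obtain ⟨t, ht1, ht2, ht3⟩ := tauPlus_lt_iff.1 (ha.trans_lt (WithTop.coe_lt_coe.2 hb))
  by_cases hta : a ≤ t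
  · exact lt_asymm ht3 (hab ⟨hta, WithTop.coe_lt_coe.1 ht2⟩)
  · exact ht3.not_ge (phi_le_of_lt_tauPlus ht1 (ha ▸ WithTop.coe_lt_coe.2 (not_le.1 hta)))

/-- At a finite upward passage time the chain is in `E₊`: just after it the functional is
increasing, and the state is constant. -/
theorem coord_tauPlus [Finite E] {ℓ s a : ℝ≥0} {ω : CadlagPath E} (ha : tauPlus v ℓ s ω = a) :
    ∃ i, coord a ω = some i ∧ 0 < v i := by
  have hsa : s ≤ a := WithTop.coe_le_coe.1 (ha ▸ le_tauPlus ℓ s ω)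
  obtain ⟨b, hb, hab⟩ := (mem_nhdsGT_iff_exists_Ioo_subset).1 (coord_rightCont ω a)
  obtain ⟨t, ht1, ht2, ht3⟩ := tauPlus_lt_iff.1 (ha.trans_lt (WithTop.coe_lt_coe.2 hb))
  have hta : a ≤ t := by
    by_contra! h
    exact ht3.not_ge (phi_le_of_lt_tauPlus ht1 (ha ▸ WithTop.coe_lt_coe.2 h))
  have htb : t < b := WithTop.coe_lt_coe.1 ht2
  rw [phi_add v s a t ω, phi_tauPlus ha, phi_of_const v hta (x := coord a ω)
    fun u hu hut => hab ⟨hu, hut.trans htb⟩] at ht3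
  have hpos : 0 < ((t : ℝ) - a) * extCoffin v (coord a ω) := by linarith
  have h2 : 0 < extCoffin v (coord a ω) :=
    pos_of_mul_pos_right hpos (sub_nonneg.2 (NNReal.coe_le_coe.2 hta))
  cases hx : coord a ω with
  | none => simp [hx, extCoffin] at h2
  | some i => exact ⟨i, rfl, by simpa [hx, extCoffin] using h2⟩

theorem tauPlus_eq_shift (ℓ s : ℝ≥0) (ω : CadlagPath E) :
    tauPlus v ℓ s ω = (s : WithTop ℝ≥0) + tauPlus v ℓ 0 (shift s ω) := by
  refine le_antisymm ?_ (le_sInf ?_)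
  · have hmem : ∀ u : ℝ≥0, (ℓ : ℝ) < phi v 0 (shift s ω) (u : WithTop ℝ≥0) →
        tauPlus v ℓ s ω ≤ ((s + u : ℝ≥0) : WithTop ℝ≥0) := fun u hu =>
      sInf_le ⟨WithTop.coe_le_coe.2 le_self_add, by rwa [phi_shift]⟩
    cases hτ : tauPlus v ℓ s ω with
    | top =>
      rw [hτ] at hmem
      have h0 : tauPlus v ℓ 0 (shift s ω) = ⊤ := by
        refine sInf_eq_top.2 fun t ht => ?_
        cases t with
        | top => rfl
        | coe u => exact absurd (hmem u ht.2) (WithTop.coe_lt_top _).not_ge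
      rw [h0, WithTop.add_top]
    | coe b =>
      rw [hτ] at hmem
      obtain ⟨d, rfl⟩ := exists_add_of_le (WithTop.coe_le_coe.1 (hτ ▸ le_tauPlus ℓ s ω))
      rw [WithTop.coe_add]
      refine add_le_add le_rfl (le_sInf fun t ht => ?_)
      cases t with
      | top => exact le_top
      | coe u =>
        exact WithTop.coe_le_coe.2 (le_of_add_le_add_left (WithTop.coe_le_coe.1 (hmem u ht.2)))
  · rintro t ⟨h1, h2⟩
    cases t with
    | top => exact le_top
    | coe t =>
      obtain ⟨d, rfl⟩ := exists_add_of_le (WithTop.coe_le_coe.1 h1)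
      rw [phi_shift] at h2
      rw [WithTop.coe_add]
      exact add_le_add le_rfl (sInf_le ⟨WithTop.coe_le_coe.2 zero_le, h2⟩)

/-- Restarting the functional at a time before which the level has not been passed. -/
theorem tauPlus_restart [Finite E] {ℓ ℓ' s σ : ℝ≥0} {ω : CadlagPath E} (hsσ : s ≤ σ)
    (hσ : phi v s ω (σ : WithTop ℝ≥0) + ℓ' = ℓ) (hle : (σ : WithTop ℝ≥0) ≤ tauPlus v ℓ s ω) :
    tauPlus v ℓ s ω = tauPlus v ℓ' σ ω := by
  refine le_antisymm (le_sInf ?_) (le_sInf ?_)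
  · rintro t ⟨h1, h2⟩
    cases t with
    | top => exact le_top
    | coe t =>
      refine sInf_le ⟨(WithTop.coe_le_coe.2 hsσ).trans h1, ?_⟩
      rw [phi_add v s σ t ω]
      linarith
  · rintro t ⟨h1, h2⟩
    cases t with
    | top => exact le_top
    | coe t =>
      refine sInf_le ⟨hle.trans (sInf_le ⟨h1, h2⟩), ?_⟩
      rw [phi_add v s σ t ω] at h2
      linarith

theorem tauPlus_freeze_lt_iff {ℓ s r : ℝ≥0} {ω : CadlagPath E} {a : WithTop ℝ≥0}
    (ha : a ≤ r) : tauPlus v ℓ s (freeze s r ω) < a ↔ tauPlus v ℓ s ω < a := by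
  simp only [tauPlus_lt_iff]
  refine exists_congr fun t => and_congr_right fun h1 => and_congr_right fun h2 => ?_
  rw [phi_freeze v h1 (WithTop.coe_le_coe.1 (h2.le.trans ha))]

theorem measurable_tauPlus [Finite E] (ℓ s : ℝ≥0) : Measurable (tauPlus v ℓ s) := by
  have h0 : Measurable (tauPlus v ℓ 0) := by
    refine measurable_of_Iio fun a => ?_
    obtain ⟨D, hDc, hD⟩ := TopologicalSpace.exists_countable_dense ℝ≥0
    have h : tauPlus v ℓ 0 ⁻¹' Set.Iio a = ⋃ t ∈ D, ⋃ _ : (t : WithTop ℝ≥0) < a,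
        {ω | (ℓ : ℝ) < phi v 0 ω (t : WithTop ℝ≥0)} := by
      ext ω
      simp only [Set.mem_preimage, Set.mem_Iio, tauPlus_lt_iff, Set.mem_iUnion, exists_prop,
        Set.mem_ofPred_eq, zero_le, true_and]
      constructor
      · rintro ⟨t, ht1, ht2⟩
        have ho : IsOpen
            {u : ℝ≥0 | (u : WithTop ℝ≥0) < a ∧ (ℓ : ℝ) < phi v 0 ω (u : WithTop ℝ≥0)} :=
          (isOpen_Iio.preimage WithTop.continuous_coe).inter
            (isOpen_lt continuous_const (continuous_phi v 0 ω))
        obtain ⟨u, hu, huD⟩ := hD.exists_mem_open ho ⟨t, ht1, ht2⟩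
        exact ⟨u, hu, huD.1, huD.2⟩
      · rintro ⟨t, -, h⟩
        exact ⟨t, h⟩
    rw [h]
    exact MeasurableSet.biUnion hDc fun t _ => MeasurableSet.iUnion fun _ =>
      measurableSet_lt measurable_const (measurable_phi v t)
  have h1 : Measurable fun t : WithTop ℝ≥0 => (s : WithTop ℝ≥0) + t :=
    Monotone.measurable fun _ _ h => add_le_add le_rfl h
  have h2 := h1.comp (h0.comp (measurable_shift s))
  rwa [show tauPlus v ℓ s = _ from funext fun ω => tauPlus_eq_shift ℓ s ω]

theorem isStoppingTime_tauPlus [Finite E] (ℓ s : ℝ≥0) :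
    IsStoppingTime (filt s) (tauPlus v ℓ s) := by
  intro t
  by_cases hst : s ≤ t
  · refine (measurableSet_filt_iff hst).2 ⟨measurableSet_Iic.preimage (measurable_tauPlus ℓ s),
      fun r hr ω => ?_⟩
    simp only [Set.mem_ofPred_eq]
    -- `τ ≤ t` holds when `τ < a` for all `a ∈ (t, r]`
    have h : ∀ ω : CadlagPath E, tauPlus v ℓ s ω ≤ t ↔
        ∀ a : ℝ≥0, t < a → a ≤ r → tauPlus v ℓ s ω < a := by
      intro ω
      constructor
      · exact fun h a hta _ => h.trans_lt (WithTop.coe_lt_coe.2 hta)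
      · intro h
        by_contra! hlt
        obtain ⟨c, hc1, hc2⟩ := exists_between (lt_min hlt (WithTop.coe_lt_coe.2 hr))
        obtain ⟨b, rfl⟩ := WithTop.ne_top_iff_exists.1 (hc2.trans_le le_top).ne
        exact (h b (WithTop.coe_lt_coe.1 hc1)
          (WithTop.coe_le_coe.1 (hc2.le.trans (min_le_right _ _)))).not_gt
            (hc2.trans_le (min_le_left _ _))
    rw [h, h]
    exact forall_congr' fun a => imp_congr_right fun _ => forall_congr' fun har =>
      tauPlus_freeze_lt_iff (WithTop.coe_le_coe.2 har)
  · convert @MeasurableSet.empty _ (filt s t) using 1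
    refine Set.eq_empty_of_forall_notMem fun ω hω => hst ?_
    exact WithTop.coe_le_coe.1 ((le_tauPlus ℓ s ω).trans hω)

theorem tauMinus_eq (ℓ s : ℝ≥0) (ω : CadlagPath E) : tauMinus v ℓ s ω = tauPlus (-v) ℓ s ω := by
  simp only [tauMinus, tauPlus, phi_neg, lt_neg]

theorem xiMinus_eq (ℓm ℓp s : ℝ≥0) (ω : CadlagPath E) :
    xiMinus v ℓm ℓp s ω = xiPlus (-v) ℓp ℓm s ω := by
  simp only [xiMinus, xiPlus, phi_neg, lt_neg, tauMinus_eq, neg_neg]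

theorem xiPlus_of_lt {ℓm ℓp s : ℝ≥0} {ω : CadlagPath E}
    (h : tauPlus v ℓp s ω < tauMinus v ℓm s ω) : xiPlus v ℓm ℓp s ω = tauPlus v ℓp s ω := by
  refine le_antisymm (le_of_forall_gt fun c hc => ?_) (le_sInf fun t ht => sInf_le ⟨ht.1, ht.2.2⟩)
  obtain ⟨t, ht1, ht2, ht3⟩ := tauPlus_lt_iff.1 (lt_min hc h)
  exact sInf_lt_iff.2 ⟨t, ⟨WithTop.coe_le_coe.2 ht1, ht2.trans_le (min_le_right _ _), ht3⟩,
    ht2.trans_le (min_le_left _ _)⟩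

theorem xiPlus_of_le {ℓm ℓp s : ℝ≥0} {ω : CadlagPath E}
    (h : tauMinus v ℓm s ω ≤ tauPlus v ℓp s ω) : xiPlus v ℓm ℓp s ω = ⊤ := by
  rw [xiPlus, sInf_eq_top]
  rintro t ⟨h1, h2, h3⟩
  exact absurd (h2.trans_le (h.trans (sInf_le ⟨h1, h3⟩))) (lt_irrefl _)

end Paths

/-! ### Evaluation along the path at a random time -/

section Eval

variable {E : Type*}

theorem evalAtFull_top (G : ℝ≥0 → E → ℝ) (x : Option E) : evalAtFull G ⊤ x = 0 := by
  cases x <;> rfl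

theorem abs_evalAtFull_le {G : ℝ≥0 → E → ℝ} {C : ℝ} (hC : 0 ≤ C) (h : ∀ s i, |G s i| ≤ C)
    (t : WithTop ℝ≥0) (x : Option E) : |evalAtFull G t x| ≤ C := by
  cases t with
  | top => simpa [evalAtFull_top] using hC
  | coe t =>
    cases x with
    | none => simpa [evalAtFull] using hC
    | some i => exact h t i

theorem coordTop_add (s : ℝ≥0) (t : WithTop ℝ≥0) (ω : CadlagPath E) :
    coordTop ω ((s : WithTop ℝ≥0) + t) = coordTop (shift s ω) t := by
  cases t with
  | top => rw [WithTop.add_top]; rfl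
  | coe t => rfl

theorem IsBb.bound {S : Type*} {G : ℝ≥0 → S → ℝ} (hG : IsBb G) :
    ∃ C, 0 ≤ C ∧ ∀ s i, |G s i| ≤ C := by
  obtain ⟨C, hC⟩ := hG.2
  exact ⟨max C 0, le_max_right _ _, fun s i => (hC s i).trans (le_max_left _ _)⟩

theorem IsBb.measurable_evalAtFull [Finite E] {G : ℝ≥0 → E → ℝ} (hG : IsBb G) :
    Measurable fun p : ℝ≥0 × Option E => evalAtFull G (p.1 : WithTop ℝ≥0) p.2 := by
  refine measurable_from_prod_countable_left fun x => ?_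
  cases x with
  | none => exact measurable_const
  | some i => exact hG.1 i

/-- The value of `G` at the point reached at the random time `t + T` by a path started at time
`t`. -/
theorem measurable_eval_shifted [Finite E] {G : ℝ≥0 → E → ℝ} (hG : IsBb G)
    {T : CadlagPath E → WithTop ℝ≥0} (hT : Measurable T) :
    Measurable fun p : ℝ≥0 × CadlagPath E =>
      evalAtFull G ((p.1 : WithTop ℝ≥0) + T p.2) (coordTop p.2 (T p.2)) := by
  have hσ : Measurable fun p : ℝ≥0 × CadlagPath E => (T p.2).untopD 0 :=
    (hT.untopD 0).comp measurable_snd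
  have h1 : Measurable fun p : ℝ≥0 × CadlagPath E =>
      (p.1 + (T p.2).untopD 0, coord ((T p.2).untopD 0) p.2) :=
    (measurable_fst.add hσ).prodMk (measurable_coord_uncurry.comp (hσ.prodMk measurable_snd))
  have h2 : MeasurableSet {p : ℝ≥0 × CadlagPath E | T p.2 ≠ ⊤} :=
    ((measurableSet_singleton _).preimage (hT.comp measurable_snd)).compl
  convert (hG.measurable_evalAtFull.comp h1).indicator h2 using 1
  ext p
  by_cases h : T p.2 = ⊤
  · rw [Set.indicator_of_notMem (by simpa using h), h, WithTop.add_top, evalAtFull_top]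
  · rw [Set.indicator_of_mem (show p ∈ {p : ℝ≥0 × CadlagPath E | T p.2 ≠ ⊤} from h),
      coordTop_of_ne_top h]
    obtain ⟨a, ha⟩ := WithTop.ne_top_iff_exists.1 h
    simp only [Function.comp_apply, ← ha]
    rfl

theorem measurable_eval [Finite E] {G : ℝ≥0 → E → ℝ} (hG : IsBb G)
    {T : CadlagPath E → WithTop ℝ≥0} (hT : Measurable T) :
    Measurable fun ω => evalAtFull G (T ω) (coordTop ω (T ω)) := by
  have h := (measurable_eval_shifted hG hT).comp (measurable_prodMk_left (x := 0))
  convert h using 1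
  ext ω
  simp only [Function.comp_apply]
  rw [WithTop.coe_zero, zero_add]

theorem integrable_eval [Finite E] {G : ℝ≥0 → E → ℝ} (hG : IsBb G)
    {T : CadlagPath E → WithTop ℝ≥0} (hT : Measurable T) (μ : Measure (CadlagPath E))
    [IsFiniteMeasure μ] : Integrable (fun ω => evalAtFull G (T ω) (coordTop ω (T ω))) μ := by
  obtain ⟨C, hC0, hC⟩ := hG.bound
  exact Integrable.of_bound (measurable_eval hG hT).aestronglyMeasurable C
    (Eventually.of_forall fun ω => abs_evalAtFull_le hC0 hC _ _)

end Eval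

/-! ### Exit times from an interval -/

section Xi

variable {E : Type*} {v : E → ℝ}

theorem tauMinus_eq_shift (ℓ s : ℝ≥0) (ω : CadlagPath E) :
    tauMinus v ℓ s ω = (s : WithTop ℝ≥0) + tauMinus v ℓ 0 (shift s ω) := by
  simp only [tauMinus_eq, tauPlus_eq_shift ℓ s ω]

theorem le_xiPlus (ℓm ℓp s : ℝ≥0) (ω : CadlagPath E) :
    (s : WithTop ℝ≥0) ≤ xiPlus v ℓm ℓp s ω := le_sInf fun _ h => h.1

theorem xiPlus_eq_shift (ℓm ℓp s : ℝ≥0) (ω : CadlagPath E) :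
    xiPlus v ℓm ℓp s ω = (s : WithTop ℝ≥0) + xiPlus v ℓm ℓp 0 (shift s ω) := by
  rcases lt_or_ge (tauPlus v ℓp 0 (shift s ω)) (tauMinus v ℓm 0 (shift s ω)) with h | h
  · rw [xiPlus_of_lt h, ← tauPlus_eq_shift, xiPlus_of_lt]
    rw [tauPlus_eq_shift, tauMinus_eq_shift]
    exact WithTop.add_lt_add_left WithTop.coe_ne_top h
  · rw [xiPlus_of_le h, WithTop.add_top, xiPlus_of_le]
    rw [tauPlus_eq_shift, tauMinus_eq_shift]
    exact add_le_add le_rfl h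

/-- The exit time through the upper end is the upward passage time on the event that this comes
first, and infinite otherwise. -/
theorem xiPlus_cases (ℓm ℓp s : ℝ≥0) (ω : CadlagPath E) :
    xiPlus v ℓm ℓp s ω = ⊤ ∨ xiPlus v ℓm ℓp s ω = tauPlus v ℓp s ω :=
  (lt_or_ge (tauPlus v ℓp s ω) (tauMinus v ℓm s ω)).elim (fun h => Or.inr (xiPlus_of_lt h))
    fun h => Or.inl (xiPlus_of_le h)

theorem isStoppingTime_xiPlus [Finite E] (ℓm ℓp s : ℝ≥0) :
    IsStoppingTime (filt s) (xiPlus v ℓm ℓp s) := by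
  have hp := isStoppingTime_tauPlus (v := v) ℓp s
  have hm : IsStoppingTime (filt s) (tauMinus v ℓm s) := by
    rw [show tauMinus v ℓm s = tauPlus (-v) ℓm s from funext fun ω => tauMinus_eq ℓm s ω]
    exact isStoppingTime_tauPlus ℓm s
  intro t
  have h := (hm.measurableSet_stopping_time_le hp).compl.2 t
  convert h using 1
  ext ω
  simp only [Set.mem_ofPred_eq, Set.mem_inter_iff, Set.mem_compl_iff, not_le]
  rcases lt_or_ge (tauPlus v ℓp s ω) (tauMinus v ℓm s ω) with h | h
  · rw [xiPlus_of_lt h]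
    exact (and_iff_right h).symm
  · rw [xiPlus_of_le h]
    exact iff_of_false (WithTop.coe_lt_top t).not_ge fun h' => h'.1.not_ge h

theorem measurable_xiPlus [Finite E] (ℓm ℓp s : ℝ≥0) : Measurable (xiPlus v ℓm ℓp s) :=
  (isStoppingTime_xiPlus ℓm ℓp s).measurable'

/-- The upward and the downward passage times cannot be equal and finite. -/
theorem tauPlus_ne_tauMinus [Finite E] {ℓp ℓm s : ℝ≥0} {ω : CadlagPath E}
    (h : tauPlus v ℓp s ω ≠ ⊤) : tauPlus v ℓp s ω ≠ tauMinus v ℓm s ω := by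
  intro heq
  obtain ⟨a, ha⟩ := WithTop.ne_top_iff_exists.1 h
  obtain ⟨i, hi, hvi⟩ := coord_tauPlus ha.symm
  rw [tauMinus_eq] at heq
  obtain ⟨j, hj, hvj⟩ := coord_tauPlus (heq.symm.trans ha.symm)
  rw [hi, Option.some_inj] at hj
  subst hj
  simp only [Pi.neg_apply] at hvj
  linarith

end Xi

/-! ### The passage and exit operators on functions on the whole state space -/

section Operators

variable {E : Type*} [Fintype E] {Λ : ℝ≥0 → Matrix E E ℝ} (M : StandardMarkovFamily E Λ)
  (v : E → ℝ)

/-- The operator `G ↦ 𝔼_{s,i} G(τ⁺_ℓ, X_{τ⁺_ℓ})` on functions on `[0, ∞) × E`, for all starting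
states `i`. For `-v` in place of `v` it is the downward passage operator. -/
def passage (ℓ : ℝ≥0) (G : ℝ≥0 → E → ℝ) : ℝ≥0 → E → ℝ := fun s i =>
  ∫ ω, evalAtFull G (tauPlus v ℓ s ω) (coordTop ω (tauPlus v ℓ s ω)) ∂(M.P s (some i))

/-- The operator `G ↦ 𝔼_{s,i} G(ξ⁺, X_{ξ⁺})` on functions on `[0, ∞) × E`. -/
def exitUp (ℓm ℓp : ℝ≥0) (G : ℝ≥0 → E → ℝ) : ℝ≥0 → E → ℝ := fun s i =>
  ∫ ω, evalAtFull G (xiPlus v ℓm ℓp s ω) (coordTop ω (xiPlus v ℓm ℓp s ω)) ∂(M.P s (some i))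

/-- The expected value of a bounded Borel function at a time that is a fixed functional of the
shifted path is Borel in the starting time. -/
theorem isBb_of_shifted {T : ℝ≥0 → CadlagPath E → WithTop ℝ≥0}
    (hT : Measurable (T 0)) (hsh : ∀ s ω, T s ω = (s : WithTop ℝ≥0) + T 0 (shift s ω))
    {G : ℝ≥0 → E → ℝ} (hG : IsBb G) :
    IsBb fun s i => ∫ ω, evalAtFull G (T s ω) (coordTop ω (T s ω)) ∂(M.P s (some i)) := by
  obtain ⟨C, hC0, hC⟩ := hG.bound
  refine ⟨fun i => ?_, C, fun s i => ?_⟩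
  · have hm := measurable_eval_shifted hG hT
    let κ : Kernel ℝ≥0 (CadlagPath E) :=
      (shiftKernel M).comap (fun s => (s, some i)) measurable_prodMk_right
    have h := (hm.stronglyMeasurable.integral_kernel_prod_right' (κ := κ)).measurable
    convert h using 2 with s
    rw [Kernel.comap_apply]
    refine Eq.trans ?_ (integral_shiftKernel M s (some i) (hm.comp measurable_prodMk_left)).symm
    simp only [hsh s, coordTop_add, Function.comp_apply]
  · refine (norm_integral_le_of_norm_le_const (μ := M.P s (some i)) (C := C)
      (f := fun ω => evalAtFull G (T s ω) (coordTop ω (T s ω))) (Eventually.of_forall fun ω =>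
      abs_evalAtFull_le hC0 hC _ _)).trans ?_
    simp

variable {M v}

theorem isBb_passage (ℓ : ℝ≥0) {G : ℝ≥0 → E → ℝ} (hG : IsBb G) : IsBb (passage M v ℓ G) :=
  isBb_of_shifted M (measurable_tauPlus ℓ 0) (tauPlus_eq_shift ℓ) hG

theorem isBb_exitUp (ℓm ℓp : ℝ≥0) {G : ℝ≥0 → E → ℝ} (hG : IsBb G) : IsBb (exitUp M v ℓm ℓp G) :=
  isBb_of_shifted M (measurable_xiPlus ℓm ℓp 0) (xiPlus_eq_shift ℓm ℓp) hG

theorem abs_passage_le {ℓ s : ℝ≥0} {i : E} {G : ℝ≥0 → E → ℝ} {C : ℝ} (hC : 0 ≤ C)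
    (h : ∀ t, s ≤ t → ∀ j, |G t j| ≤ C) : |passage M v ℓ G s i| ≤ C := by
  refine (norm_integral_le_of_norm_le_const (μ := M.P s (some i)) (C := C)
    (f := fun ω => evalAtFull G (tauPlus v ℓ s ω) (coordTop ω (tauPlus v ℓ s ω)))
    (Eventually.of_forall fun ω => ?_)).trans ?_
  · have hs := le_tauPlus (v := v) ℓ s ω
    generalize tauPlus v ℓ s ω = τ at *
    cases τ with
    | top => simpa [evalAtFull_top] using hC
    | coe t =>
      generalize coordTop ω (t : WithTop ℝ≥0) = x
      cases x with
      | none => simpa [evalAtFull] using hC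
      | some j => exact h t (WithTop.coe_le_coe.1 hs) j
  · simp

theorem evalAtFull_tauPlus_congr {G G' : ℝ≥0 → E → ℝ} (h : ∀ t i, 0 < v i → G t i = G' t i)
    (ℓ s : ℝ≥0) (ω : CadlagPath E) :
    evalAtFull G (tauPlus v ℓ s ω) (coordTop ω (tauPlus v ℓ s ω)) =
      evalAtFull G' (tauPlus v ℓ s ω) (coordTop ω (tauPlus v ℓ s ω)) := by
  cases hτ : tauPlus v ℓ s ω with
  | top => simp only [evalAtFull_top]
  | coe a =>
    obtain ⟨i, hi, hv⟩ := coord_tauPlus hτ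
    change evalAtFull G a (coord a ω) = evalAtFull G' a (coord a ω)
    rw [hi]
    exact h a i hv

theorem passage_congr {G G' : ℝ≥0 → E → ℝ} (h : ∀ t i, 0 < v i → G t i = G' t i) (ℓ : ℝ≥0) :
    passage M v ℓ G = passage M v ℓ G' := by
  funext s i
  simp only [passage, evalAtFull_tauPlus_congr h]

theorem exitUp_congr {G G' : ℝ≥0 → E → ℝ} (h : ∀ t i, 0 < v i → G t i = G' t i) (ℓm ℓp : ℝ≥0) :
    exitUp M v ℓm ℓp G = exitUp M v ℓm ℓp G' := by
  funext s i
  refine integral_congr_ae (Eventually.of_forall fun ω => ?_)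
  dsimp only
  rcases xiPlus_cases (v := v) ℓm ℓp s ω with h' | h'
  · simp only [h', evalAtFull_top]
  · rw [h', evalAtFull_tauPlus_congr h]

theorem exitUp_sub {G G' : ℝ≥0 → E → ℝ} (hG : IsBb G) (hG' : IsBb G') (ℓm ℓp s : ℝ≥0) (i : E) :
    exitUp M v ℓm ℓp (fun t j => G t j - G' t j) s i =
      exitUp M v ℓm ℓp G s i - exitUp M v ℓm ℓp G' s i := by
  have hm := measurable_xiPlus (v := v) ℓm ℓp s
  rw [exitUp, exitUp, exitUp, ← integral_sub (integrable_eval hG hm _) (integrable_eval hG' hm _)]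
  refine integral_congr_ae (Eventually.of_forall fun ω => ?_)
  dsimp only
  generalize xiPlus v ℓm ℓp s ω = τ
  cases τ with
  | top => simp only [evalAtFull_top, sub_zero]
  | coe t =>
    generalize coordTop ω (t : WithTop ℝ≥0) = x
    cases x with
    | none => simp [evalAtFull]
    | some j => rfl

theorem hasSum_passage {a : ℕ → ℝ≥0 → E → ℝ} (ha : ∀ n, IsBb (a n)) {b : ℕ → ℝ} (hb : Summable b)
    (hb0 : ∀ n, 0 ≤ b n) (hab : ∀ n t j, |a n t j| ≤ b n) (ℓ s : ℝ≥0) (i : E) :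
    HasSum (fun n => passage M v ℓ (a n) s i)
      (passage M v ℓ (fun t j => ∑' n, a n t j) s i) := by
  have hm := measurable_tauPlus (v := v) ℓ s
  have h := hasSum_integral_of_summable_integral_norm (E := ℝ) (μ := M.P s (some i))
    (F := fun n ω => evalAtFull (a n) (tauPlus v ℓ s ω) (coordTop ω (tauPlus v ℓ s ω)))
    (fun n => integrable_eval (ha n) hm _) ?_
  · suffices heq : passage M v ℓ (fun t j => ∑' n, a n t j) s i = ∫ ω, ∑' n,
        evalAtFull (a n) (tauPlus v ℓ s ω) (coordTop ω (tauPlus v ℓ s ω)) ∂(M.P s (some i)) by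
      rw [heq]
      exact h
    refine integral_congr_ae (Eventually.of_forall fun ω => ?_)
    dsimp only
    generalize tauPlus v ℓ s ω = τ
    cases τ with
    | top => simp only [evalAtFull_top, tsum_zero]
    | coe t =>
      generalize coordTop ω (t : WithTop ℝ≥0) = x
      cases x with
      | none => simp [evalAtFull]
      | some j => rfl
  · refine hb.of_nonneg_of_le (fun n => integral_nonneg fun ω => norm_nonneg _) fun n => ?_
    refine (integral_mono (integrable_eval (ha n) hm _).norm (integrable_const (b n)) fun ω =>
      abs_evalAtFull_le (hb0 n) (hab n) _ _).trans ?_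
    simp

/-! ### Composition of passage operators by the strong Markov property -/

/-- Restarting the chain at a stopping time and running it up to a passage time. -/
theorem integral_passage_comp (s : ℝ≥0) (x : Option E) {τ : CadlagPath E → WithTop ℝ≥0}
    (hτ : IsStoppingTime (filt s) τ) (hs : ∀ ω, (s : WithTop ℝ≥0) ≤ τ ω)
    (halive : ∀ ω, τ ω ≠ ⊤ → coordTop ω (τ ω) ≠ none) (ℓ : ℝ≥0) {G : ℝ≥0 → E → ℝ} (hG : IsBb G) :
    ∫ ω, evalAtFull (passage M v ℓ G) (τ ω) (coordTop ω (τ ω)) ∂(M.P s x) =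
      ∫ ω in {ω | τ ω ≠ ⊤}, evalAtFull G (tauPlus v ℓ ((τ ω).untopD 0) ω)
        (coordTop ω (tauPlus v ℓ ((τ ω).untopD 0) ω)) ∂(M.P s x) := by
  obtain ⟨C, hC0, hC⟩ := hG.bound
  have hT : MeasurableSet {ω | τ ω ≠ ⊤} := hτ.measurableSet_eq_top.compl
  have h := strongMarkov_integral M s x hτ hs
    (measurable_eval_shifted hG (measurable_tauPlus (v := v) ℓ 0))
    (fun p => abs_evalAtFull_le hC0 hC _ _)
  simp only [← tauPlus_eq_shift, ← coordTop_add] at h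
  rw [h, ← integral_indicator hT]
  refine integral_congr_ae (Eventually.of_forall fun ω => ?_)
  dsimp only
  by_cases hω : τ ω = ⊤
  · rw [Set.indicator_of_notMem (by simpa using hω), hω, evalAtFull_top]
  · rw [Set.indicator_of_mem (show ω ∈ {ω | τ ω ≠ ⊤} from hω)]
    have ha := halive ω hω
    rw [coordTop_of_ne_top hω] at ha ⊢
    obtain ⟨i, hi⟩ := Option.ne_none_iff_exists'.1 ha
    rw [hi]
    obtain ⟨a, ha⟩ := WithTop.ne_top_iff_exists.1 hω
    rw [← ha]
    rfl

theorem coordTop_tauPlus_ne_none {ℓ s : ℝ≥0} {ω : CadlagPath E} (h : tauPlus v ℓ s ω ≠ ⊤) :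
    coordTop ω (tauPlus v ℓ s ω) ≠ none := by
  obtain ⟨a, ha⟩ := WithTop.ne_top_iff_exists.1 h
  obtain ⟨i, hi, -⟩ := coord_tauPlus ha.symm
  rw [← ha]
  change coord a ω ≠ none
  rw [hi]
  exact Option.some_ne_none i

theorem tauPlus_mono {E : Type*} {v : E → ℝ} {ℓ ℓ' : ℝ≥0} (h : ℓ ≤ ℓ') (s : ℝ≥0)
    (ω : CadlagPath E) : tauPlus v ℓ s ω ≤ tauPlus v ℓ' s ω :=
  sInf_le_sInf fun _ ht => ⟨ht.1, (NNReal.coe_le_coe.2 h).trans_lt ht.2⟩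

/-- To pass the level `ℓ` the functional first has to pass the level `0`. -/
theorem passage_zero_passage (ℓ : ℝ≥0) {G : ℝ≥0 → E → ℝ} (hG : IsBb G) :
    passage M v 0 (passage M v ℓ G) = passage M v ℓ G := by
  funext s i
  have hτ := isStoppingTime_tauPlus (v := v) 0 s
  have hT : MeasurableSet {ω | tauPlus v 0 s ω ≠ ⊤} := hτ.measurableSet_eq_top.compl
  rw [passage, integral_passage_comp s (some i) hτ (le_tauPlus 0 s)
    (fun ω h => coordTop_tauPlus_ne_none h) ℓ hG, ← integral_indicator hT, passage]
  refine integral_congr_ae (Eventually.of_forall fun ω => ?_)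
  dsimp only
  have hle := tauPlus_mono (v := v) (zero_le : 0 ≤ ℓ) s ω
  by_cases hω : tauPlus v 0 s ω = ⊤
  · rw [Set.indicator_of_notMem (by simpa using hω),
      show tauPlus v ℓ s ω = ⊤ from top_le_iff.1 (hω ▸ hle), evalAtFull_top]
  · rw [Set.indicator_of_mem (show ω ∈ {ω | tauPlus v 0 s ω ≠ ⊤} from hω)]
    obtain ⟨a, ha⟩ := WithTop.ne_top_iff_exists.1 hω
    have h0 := le_tauPlus (v := v) 0 s ω
    rw [← ha] at h0 hle ⊢
    rw [WithTop.untopD_coe, ← tauPlus_restart (WithTop.coe_le_coe.1 h0) ?_ hle]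
    rw [phi_tauPlus ha.symm]
    simp

/-- The decomposition of an upward passage at the exit from the interval `[-ℓ⁻, ℓ⁺]`: either the
functional leaves the interval upwards, or it leaves it downwards and then has to climb by
`ℓ⁻ + ℓ⁺`. -/
theorem passage_eq_exitUp_add (ℓm ℓp : ℝ≥0) {G : ℝ≥0 → E → ℝ} (hG : IsBb G) (s : ℝ≥0) (i : E) :
    passage M v ℓp G s i = exitUp M v ℓm ℓp G s i +
      exitUp M (-v) ℓp ℓm (passage M v (ℓm + ℓp) G) s i := by
  have hτ := isStoppingTime_xiPlus (v := -v) ℓp ℓm s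
  have hT : MeasurableSet {ω | xiPlus (-v) ℓp ℓm s ω ≠ ⊤} := hτ.measurableSet_eq_top.compl
  have halive : ∀ ω, xiPlus (-v) ℓp ℓm s ω ≠ ⊤ →
      coordTop ω (xiPlus (-v) ℓp ℓm s ω) ≠ none := by
    intro ω h
    have h' := (xiPlus_cases ℓp ℓm s ω).resolve_left h
    rw [h'] at h ⊢
    exact coordTop_tauPlus_ne_none h
  rw [← sub_eq_iff_eq_add', passage, exitUp, ← integral_sub
    (integrable_eval hG (measurable_tauPlus ℓp s) _)
    (integrable_eval hG (measurable_xiPlus ℓm ℓp s) _), exitUp,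
    integral_passage_comp s (some i) hτ (le_xiPlus ℓp ℓm s) halive (ℓm + ℓp) hG,
    ← integral_indicator hT]
  refine integral_congr_ae (Eventually.of_forall fun ω => ?_)
  dsimp only
  have hmm : tauMinus (-v) ℓp s ω = tauPlus v ℓp s ω := by rw [tauMinus_eq, neg_neg]
  rcases lt_or_ge (tauPlus (-v) ℓm s ω) (tauPlus v ℓp s ω) with h | h
  · have h1 : xiPlus (-v) ℓp ℓm s ω = tauPlus (-v) ℓm s ω := xiPlus_of_lt (by rwa [hmm])
    obtain ⟨a, ha⟩ := WithTop.ne_top_iff_exists.1 (h.trans_le le_top).ne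
    rw [Set.indicator_of_mem (show ω ∈ {ω | xiPlus (-v) ℓp ℓm s ω ≠ ⊤} by
      rw [Set.mem_ofPred_eq, h1, ← ha]; exact WithTop.coe_ne_top),
      xiPlus_of_le (by rw [tauMinus_eq]; exact h.le), evalAtFull_top, sub_zero, h1, ← ha,
      WithTop.untopD_coe]
    have h0 := le_tauPlus (v := -v) ℓm s ω
    rw [← ha] at h0 h
    rw [← tauPlus_restart (WithTop.coe_le_coe.1 h0) ?_ h.le]
    have h2 := phi_tauPlus ha.symm
    rw [phi_neg] at h2
    push_cast
    linarith
  · rw [Set.indicator_of_notMem (by simpa using xiPlus_of_le (v := -v) (by rwa [hmm]))]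
    by_cases htop : tauPlus v ℓp s ω = ⊤
    · rw [htop, (xiPlus_cases ℓm ℓp s ω).elim id fun h' => h'.trans htop, sub_self]
    · have h3 : tauPlus v ℓp s ω < tauMinus v ℓm s ω :=
        lt_of_le_of_ne (by rwa [tauMinus_eq]) (tauPlus_ne_tauMinus htop)
      rw [xiPlus_of_lt h3, sub_self]

/-- The point of exit from the interval is a point of upward or of downward exit. -/
theorem twoSidedExit_eq (ℓm ℓp : ℝ≥0) {G : ℝ≥0 → E → ℝ} (hG : IsBb G) (s : ℝ≥0) (i : E) :
    twoSidedExit M v ℓm ℓp G s i = exitUp M v ℓm ℓp G s i + exitUp M (-v) ℓp ℓm G s i := by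
  rw [twoSidedExit, exitUp, exitUp, ← integral_add
    (integrable_eval hG (measurable_xiPlus ℓm ℓp s) _)
    (integrable_eval hG (measurable_xiPlus ℓp ℓm s) _)]
  refine integral_congr_ae (Eventually.of_forall fun ω => ?_)
  dsimp only
  have hmm : tauMinus (-v) ℓp s ω = tauPlus v ℓp s ω := by rw [tauMinus_eq, neg_neg]
  rcases lt_trichotomy (tauPlus v ℓp s ω) (tauMinus v ℓm s ω) with h | h | h
  · rw [min_eq_right h.le, xiPlus_of_lt h, xiPlus_of_le (v := -v) (by
      rw [hmm, ← tauMinus_eq]; exact h.le), evalAtFull_top, add_zero]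
  · have htop : tauPlus v ℓp s ω = ⊤ := by
      by_contra h'
      exact tauPlus_ne_tauMinus h' h
    rw [xiPlus_of_le h.ge, xiPlus_of_le (v := -v) (by rw [hmm, ← tauMinus_eq]; exact h.le), ← h,
      min_self, htop, evalAtFull_top, add_zero]
  · rw [min_eq_left h.le, xiPlus_of_le h.le, xiPlus_of_lt (v := -v) (by
      rwa [hmm, ← tauMinus_eq]), evalAtFull_top, zero_add, ← tauMinus_eq]

end Operators

/-! ### A uniform bound on the rate of jumps between living states -/

section Jumps

variable {E : Type*} [Fintype E] {Λ : ℝ≥0 → Matrix E E ℝ} (M : StandardMarkovFamily E Λ)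

/-- The sum of the jump rates out of a state is at most this number if the entries of the generators
are bounded by `K`; the summand `1` leaves room for the error term of a right derivative. -/
def rateBound (E : Type*) [Fintype E] (K : ℝ) : ℝ := Fintype.card E * K + 1

/-- For the chain started at `t` in a state outside `D`, the probability of being in `D` after a
short time `η` is at most linear in `η`, by the generator. -/
theorem eventually_measureReal_le {K : ℝ} (hΛK : ∀ s i j, |Λ s i j| ≤ K) {D : Set (Option E)}
    (hD : none ∉ D) (t : ℝ≥0) :
    ∀ᶠ η : ℝ≥0 in 𝓝[>] 0, ∀ x, x ∉ D →
      (M.P t x).real {ω | coord (t + η) ω ∈ D} ≤ rateBound E K * η := by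
  classical
  rw [eventually_all]
  intro x
  cases x with
  | none =>
    refine Eventually.of_forall fun η _ => ?_
    have hC : 0 ≤ rateBound E K := by
      by_cases hE : IsEmpty E
      · simp [rateBound]
      · obtain ⟨i⟩ := not_isEmpty_iff.1 hE
        have : 0 ≤ K := (abs_nonneg _).trans (hΛK 0 i i)
        unfold rateBound
        positivity
    have h : (M.P t none).real {ω | coord (t + η) ω ∈ D} = 0 := by
      rw [measureReal_eq_zero_iff]
      refine measure_mono_null (fun ω hω => ?_) (M.absorbing t (t + η) le_self_add)
      simp only [Set.mem_compl_iff, Set.mem_ofPred_eq]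
      intro h
      rw [Set.mem_ofPred_eq, h] at hω
      exact hD hω
    rw [h]
    positivity
  | some i =>
    by_cases hi : some i ∈ D
    · exact Eventually.of_forall fun η h => absurd hi h
    let f : E → ℝ := fun j => if some j ∈ D then 1 else 0
    have hf : ∀ x, extCoffin f x = D.indicator 1 x := by
      rintro (_ | j)
      · simp [extCoffin, hD]
      · by_cases hj : some j ∈ D <;> simp [extCoffin, f, hj]
    have hlim := M.generator t i f
    have hrate : ((Λ t).mulVec f i) < rateBound E K := by
      have h : ((Λ t).mulVec f i) ≤ ∑ _j : E, K := by
        refine Finset.sum_le_sum fun j _ => ?_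
        have h1 := abs_le.1 (hΛK t i j)
        by_cases hj : some j ∈ D
        · simp [f, hj, h1.2]
        · simp only [f, hj, if_false, mul_zero]
          linarith
      simp only [Finset.sum_const, Finset.card_univ, nsmul_eq_mul] at h
      unfold rateBound
      linarith
    filter_upwards [hlim.eventually (gt_mem_nhds hrate), self_mem_nhdsWithin] with η hη hpos _
    have hη0 : (0 : ℝ) < η := NNReal.coe_pos.2 hpos
    rw [div_lt_iff₀ hη0] at hη
    have hint : ∫ ω, extCoffin f (coord (t + η) ω) ∂(M.P t (some i)) =
        (M.P t (some i)).real {ω | coord (t + η) ω ∈ D} := by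
      rw [← integral_indicator_one (measurableSet_coord (t + η) D)]
      simp only [hf]
      rfl
    have hfi : f i = 0 := by simp [f, hi]
    rw [hint, hfi, sub_zero] at hη
    exact hη.le

theorem measureReal_coord_add_le {K : ℝ} (hΛK : ∀ s i j, |Λ s i j| ≤ K) {D : Set (Option E)}
    (hD : none ∉ D) {s t : ℝ≥0} (hst : s ≤ t) (x : Option E) :
    ∀ᶠ η : ℝ≥0 in 𝓝[>] 0, (M.P s x).real {ω | coord (t + η) ω ∈ D} ≤
      (M.P s x).real {ω | coord t ω ∈ D} + rateBound E K * η := by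
  filter_upwards [eventually_measureReal_le M hΛK hD t] with η hη
  have hmk := markov_real M s x hst (le_self_add (b := η)) D (A := Set.univ)
    (@MeasurableSet.univ _ (filt s t))
  rw [Set.inter_univ, Measure.restrict_univ] at hmk
  have hDm := measurableSet_coord (E := E) t D
  rw [hmk, ← integral_indicator_one hDm]
  have hi1 : Integrable (fun ω : CadlagPath E =>
      (M.P t (coord t ω)).real {ω' | coord (t + η) ω' ∈ D}) (M.P s x) :=
    Integrable.of_bound ((measurable_of_countable fun z =>
      (M.P t z).real {ω' | coord (t + η) ω' ∈ D}).comp (measurable_coord t)).aestronglyMeasurable 1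
      (Eventually.of_forall fun ω => by
        rw [Real.norm_of_nonneg measureReal_nonneg]; exact measureReal_le_one)
  have hi2 : Integrable ({ω : CadlagPath E | coord t ω ∈ D}.indicator (1 : CadlagPath E → ℝ))
    (M.P s x) := (integrable_const (1 : ℝ)).indicator hDm
  have hη0 : 0 ≤ rateBound E K * η := measureReal_nonneg.trans (hη none hD)
  calc _ ≤ ∫ ω, ({ω : CadlagPath E | coord t ω ∈ D}.indicator (1 : CadlagPath E → ℝ) ω +
        rateBound E K * η) ∂(M.P s x) := by
        refine integral_mono hi1 (hi2.add (integrable_const _)) fun ω => ?_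
        dsimp only
        by_cases h : coord t ω ∈ D
        · rw [Set.indicator_of_mem (show ω ∈ {ω : CadlagPath E | coord t ω ∈ D} from h)]
          exact measureReal_le_one.trans (le_add_of_nonneg_right hη0)
        · rw [Set.indicator_of_notMem (show ω ∉ {ω : CadlagPath E | coord t ω ∈ D} from h),
            zero_add]
          exact hη _ h
    _ = _ := by
        rw [integral_add hi2 (integrable_const _)]
        simp

/-- By quasi-left-continuity the probability of being in a set of living states does not jump
upwards. -/
theorem measureReal_coord_le_of_left {D : Set (Option E)} (hD : none ∉ D) {s t : ℝ≥0} (hst : s < t)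
    (x : Option E) {c : ℝ}
    (h : ∀ u, s < u → u < t → (M.P s x).real {ω | coord u ω ∈ D} ≤ c) :
    (M.P s x).real {ω | coord t ω ∈ D} ≤ c := by
  obtain ⟨u, hu, hut, hlim⟩ := exists_seq_strictMono_tendsto' hst
  have hsup : (⨆ n, ((u n : ℝ≥0) : WithTop ℝ≥0)) = t :=
    tendsto_nhds_unique
      (tendsto_atTop_iSup fun m n hmn => WithTop.coe_le_coe.2 (hu.monotone hmn))
      ((WithTop.continuous_coe.tendsto t).comp hlim)
  have hq := M.quasiLeftCont s x (fun n _ => u n) (fun n => isStoppingTime_const _ _)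
    (fun n _ => WithTop.coe_le_coe.2 (hut n).1.le)
    (fun _ m n hmn => WithTop.coe_le_coe.2 (hu.monotone hmn))
  simp only [hsup] at hq
  have hm : ∀ u, MeasurableSet {ω : CadlagPath E | coord u ω ∈ D} :=
    fun u => measurableSet_coord u D
  have ht : Tendsto (fun n => ∫ ω, ({ω | coord (u n) ω ∈ D} ∩ {ω | coord t ω ∈ D}).indicator
      (1 : CadlagPath E → ℝ) ω ∂(M.P s x)) atTop
      (𝓝 (∫ ω, {ω | coord t ω ∈ D}.indicator (1 : CadlagPath E → ℝ) ω ∂(M.P s x))) := by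
    refine tendsto_integral_of_dominated_convergence (fun _ => 1)
      (fun n => (measurable_one.indicator ((hm _).inter (hm _))).aestronglyMeasurable)
      (integrable_const _) (fun n => Eventually.of_forall fun ω => ?_) ?_
    · refine (norm_indicator_le_norm_self _ _).trans ?_
      simp
    · filter_upwards [hq] with ω hω
      refine tendsto_const_nhds.congr' ?_
      by_cases h : coord t ω ∈ D
      · have hne : coordTop ω (t : WithTop ℝ≥0) ≠ none := fun h' => hD (h' ▸ h)
        filter_upwards [hω hne] with n hn
        have hn' : coord (u n) ω = coord t ω := hn
        have h1 : ω ∈ {ω | coord (u n) ω ∈ D} := by rwa [Set.mem_ofPred_eq, hn']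
        rw [Set.indicator_of_mem (show ω ∈ {ω | coord t ω ∈ D} from h),
          Set.indicator_of_mem
            (show ω ∈ {ω | coord (u n) ω ∈ D} ∩ {ω | coord t ω ∈ D} from ⟨h1, h⟩)]
      · simp [h]
  simp only [integral_indicator_one (hm t), integral_indicator_one ((hm _).inter (hm t))] at ht
  exact le_of_tendsto' ht fun n => (measureReal_mono Set.inter_subset_left).trans
    (h (u n) (hut n).1 (hut n).2)

/-- The probability of being in a set of living states not containing the starting state grows at
most linearly. Killing at fixed times is not excluded and may only lower it. -/
theorem measureReal_coord_mem_le {K : ℝ} (hΛK : ∀ s i j, |Λ s i j| ≤ K) {D : Set (Option E)}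
    (hD : none ∉ D) {s : ℝ≥0} {x : Option E} (hx : x ∉ D) {t : ℝ≥0} (hst : s ≤ t) :
    (M.P s x).real {ω | coord t ω ∈ D} ≤ rateBound E K * ((t : ℝ) - s) := by
  by_contra! hbad
  let S : Set ℝ≥0 := {t | s ≤ t ∧
    rateBound E K * ((t : ℝ) - s) < (M.P s x).real {ω | coord t ω ∈ D}}
  have hS : S.Nonempty := ⟨t, hst, hbad⟩
  set b := sInf S with hb
  have hsb : s ≤ b := le_csInf hS fun u hu => hu.1
  have hgood : ∀ u, s ≤ u → u < b →
      (M.P s x).real {ω | coord u ω ∈ D} ≤ rateBound E K * ((u : ℝ) - s) := by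
    intro u hsu hub
    by_contra! h
    exact hub.not_ge (csInf_le (OrderBot.bddBelow S) ⟨hsu, h⟩)
  have hloc := measureReal_coord_add_le M hΛK hD hsb x
  have hC : 0 ≤ rateBound E K := by
    obtain ⟨η, hη, hpos⟩ :=
      ((eventually_measureReal_le M hΛK hD s).and self_mem_nhdsWithin).exists
    exact le_of_mul_le_mul_right (by
      rw [zero_mul]; exact measureReal_nonneg.trans (hη none hD)) (NNReal.coe_pos.2 hpos)
  have hb' : (M.P s x).real {ω | coord b ω ∈ D} ≤ rateBound E K * ((b : ℝ) - s) := by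
    rcases hsb.eq_or_lt with h | h
    · rw [← h, sub_self, mul_zero, measureReal_def]
      have h0 : (M.P s x) {ω | coord s ω ∈ D} = 0 := by
        refine measure_mono_null (fun ω hω => ?_) (M.start s x)
        simp only [Set.mem_compl_iff, Set.mem_ofPred_eq] at hω ⊢
        rintro rfl
        exact hx hω
      rw [h0, ENNReal.toReal_zero]
    · refine measureReal_coord_le_of_left M hD h x fun u hsu hub => ?_
      refine (hgood u hsu.le hub).trans (mul_le_mul_of_nonneg_left ?_ hC)
      exact sub_le_sub_right (NNReal.coe_le_coe.2 hub.le) _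
  obtain ⟨δ, hδ, hsub⟩ := mem_nhdsGT_iff_exists_Ioo_subset.1 hloc
  obtain ⟨w, ⟨hsw, hw⟩, hwb⟩ := exists_lt_of_csInf_lt hS
    (lt_add_of_pos_right b (Set.mem_Ioi.1 hδ))
  obtain ⟨η, rfl⟩ := exists_add_of_le (csInf_le (OrderBot.bddBelow S) ⟨hsw, hw⟩)
  rw [← hb] at hwb hw
  rcases eq_or_ne η 0 with rfl | hη
  · rw [add_zero] at hw
    exact hw.not_ge hb'
  · have h1 : (M.P s x).real {ω | coord (b + η) ω ∈ D} ≤ _ :=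
      hsub ⟨pos_iff_ne_zero.2 hη, lt_of_add_lt_add_left hwb⟩
    push_cast at hw
    linarith

/-- The probability of visiting a set of living states on a finite grid of times. -/
theorem measureReal_grid_le {K : ℝ} (hΛK : ∀ s i j, |Λ s i j| ≤ K) {D : Set (Option E)}
    (hD : none ∉ D) {s : ℝ≥0} {x : Option E} (hx : x ∉ D) (ε : ℝ≥0) (n : ℕ) :
    (M.P s x).real {ω | ∃ k ≤ n, coord (s + k * ε) ω ∈ D} ≤ rateBound E K * (n * ε) := by
  induction n with
  | zero =>
    have h := measureReal_coord_mem_le M hΛK hD hx (le_refl s)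
    simpa using h
  | succ n ih =>
    -- the first visit to `D` at the last grid point is a jump from outside `D`
    have hsub : {ω : CadlagPath E | ∃ k ≤ n + 1, coord (s + k * ε) ω ∈ D} ⊆
        {ω | ∃ k ≤ n, coord (s + k * ε) ω ∈ D} ∪
          ({ω | coord (s + n * ε + ε) ω ∈ D} ∩ coord (s + n * ε) ⁻¹' Dᶜ) := by
      rintro ω ⟨k, hk, hkD⟩
      by_cases h : ∃ k ≤ n, coord (s + k * ε) ω ∈ D
      · exact Or.inl h
      · push Not at h
        refine Or.inr ⟨?_, h n le_rfl⟩
        rcases Nat.le_succ_iff.1 hk with hk | rfl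
        · exact absurd hkD (h k hk)
        · rw [Nat.cast_succ, add_mul, one_mul, ← add_assoc] at hkD
          exact hkD
    have hmk := markov_real M s x (le_self_add (b := n * ε)) (le_self_add (b := ε)) D
      (measurableSet_coord_filt (le_self_add (b := n * ε)) Dᶜ)
    have hC : 0 ≤ rateBound E K * ε := by
      have := measureReal_coord_mem_le M hΛK hD hx (le_self_add (a := s) (b := ε))
      rw [NNReal.coe_add, add_sub_cancel_left] at this
      exact measureReal_nonneg.trans this
    have hA : MeasurableSet (coord (E := E) (s + n * ε) ⁻¹' Dᶜ) := measurable_coord _ trivial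
    have hjump : ∫ ω in coord (s + n * ε) ⁻¹' Dᶜ,
        (M.P (s + n * ε) (coord (s + n * ε) ω)).real {ω' | coord (s + n * ε + ε) ω' ∈ D}
          ∂(M.P s x) ≤ rateBound E K * ε := by
      refine (Real.le_norm_self _).trans ((norm_setIntegral_le_of_norm_le_const
        (C := rateBound E K * ε) (measure_lt_top _ _) fun ω hω => ?_).trans ?_)
      · rw [Real.norm_of_nonneg measureReal_nonneg]
        have := measureReal_coord_mem_le M hΛK hD (s := s + n * ε) (Set.mem_preimage.1 hω)
          (le_self_add (b := ε))
        rwa [NNReal.coe_add _ ε, add_sub_cancel_left] at this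
      · exact mul_le_of_le_one_right hC measureReal_le_one
    calc _ ≤ _ := measureReal_mono hsub
      _ ≤ _ := measureReal_union_le _ _
      _ ≤ rateBound E K * (n * ε) + rateBound E K * ε := add_le_add ih (hmk.trans_le hjump)
      _ = _ := by push_cast; ring

variable {v : E → ℝ}

/-- Started outside `E₊`, the chain needs a jump into `E₊` before an upward passage, so that a
passage within a time `δ` has probability at most linear in `δ`. -/
theorem measureReal_tauPlus_lt_le {K : ℝ} (hΛK : ∀ s i j, |Λ s i j| ≤ K) {i : E} (hi : ¬ 0 < v i)
    (ℓ s δ : ℝ≥0) :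
    (M.P s (some i)).real {ω | tauPlus v ℓ s ω < ((s + δ : ℝ≥0) : WithTop ℝ≥0)} ≤
      rateBound E K * δ := by
  let D : Set (Option E) := some '' {j | 0 < v j}
  have hD : none ∉ D := by simp [D]
  have hx : some i ∉ D := by simpa [D] using hi
  let A : ℕ → Set (CadlagPath E) := fun n =>
    {ω | ∃ k ≤ n + 1, coord (s + k * (δ / (n + 1))) ω ∈ D}
  have hAle : ∀ n, (M.P s (some i)).real (A n) ≤ rateBound E K * δ := by
    intro n
    have h := measureReal_grid_le M hΛK hD hx (s := s) (δ / (n + 1)) (n + 1)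
    push_cast at h
    rwa [mul_div_cancel₀ _ (by positivity)] at h
  have hsub : {ω | tauPlus v ℓ s ω < ((s + δ : ℝ≥0) : WithTop ℝ≥0)} ⊆
      ⋃ N, ⋂ n, ⋂ _ : N ≤ n, A n := by
    intro ω hω
    rw [Set.mem_ofPred_eq] at hω
    obtain ⟨a, ha⟩ := WithTop.ne_top_iff_exists.1 (hω.trans_le le_top).ne
    obtain ⟨j, hj, hvj⟩ := coord_tauPlus ha.symm
    have hsa := le_tauPlus (v := v) ℓ s ω
    rw [← ha] at hω hsa
    have hsa := WithTop.coe_le_coe.1 hsa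
    obtain ⟨b, hb, hab⟩ := (mem_nhdsGT_iff_exists_Ioo_subset).1 (coord_rightCont ω a)
    obtain ⟨d, rfl⟩ := exists_add_of_le hsa
    have hc : s + d < min b (s + δ) := lt_min hb (WithTop.coe_lt_coe.1 hω)
    obtain ⟨e, he⟩ := exists_add_of_le hc.le
    have he0 : 0 < e := by
      rw [he] at hc
      exact pos_of_lt_add_right hc
    have hlim : Tendsto (fun n : ℕ => δ / ((n : ℝ≥0) + 1)) atTop (𝓝 0) := by
      have := (tendsto_one_div_add_atTop_nhds_zero_nat (𝕜 := ℝ≥0)).const_mul δ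
      simpa [div_eq_mul_inv] using this
    obtain ⟨N, hN⟩ := eventually_atTop.1 (hlim.eventually (gt_mem_nhds he0))
    refine Set.mem_iUnion.2 ⟨N, Set.mem_iInter₂.2 fun n hn => ?_⟩
    have hδ0 : 0 < δ := by
      have h1 : s + d < s + δ := hc.trans_le (min_le_right _ _)
      exact zero_le.trans_lt (lt_of_add_lt_add_left h1)
    have hε0 : 0 < δ / ((n : ℝ≥0) + 1) := by positivity
    have hεe := hN n hn
    set ε := δ / ((n : ℝ≥0) + 1) with hε
    -- the grid point next to the right of the passage time `s + d`
    have h1 : d ≤ ⌈d / ε⌉₊ * ε := (div_le_iff₀ hε0).1 (Nat.le_ceil _)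
    have h2 : ⌈d / ε⌉₊ * ε < d + e := by
      have h3 : (⌈d / ε⌉₊ : ℝ≥0) < d / ε + 1 := Nat.ceil_lt_add_one zero_le
      calc _ < (d / ε + 1) * ε := mul_lt_mul_of_pos_right h3 hε0
        _ = d + ε := by rw [add_mul, div_mul_cancel₀ _ hε0.ne', one_mul]
        _ < _ := by gcongr
    have h4 : s + ⌈d / ε⌉₊ * ε < min b (s + δ) := by
      rw [he, add_assoc]
      gcongr
    refine ⟨⌈d / ε⌉₊, ?_, ?_⟩
    · have h5 : ⌈d / ε⌉₊ * ε < (n + 1) * ε := by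
        rw [hε, mul_div_cancel₀ δ (by positivity), ← hε]
        exact lt_of_add_lt_add_left (h4.trans_le (min_le_right _ _))
      have h6 := lt_of_mul_lt_mul_right h5 hε0.le
      exact_mod_cast h6.le
    · have h7 : coord (s + ⌈d / ε⌉₊ * ε) ω = coord (s + d) ω := by
        rcases (show s + d ≤ s + ⌈d / ε⌉₊ * ε by gcongr).eq_or_lt with h | h
        · rw [← h]
        · exact hab ⟨h, h4.trans_le (min_le_left _ _)⟩
      rw [h7, hj]
      exact ⟨j, hvj, rfl⟩
  have hC : 0 ≤ rateBound E K * δ := measureReal_nonneg.trans (hAle 0)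
  refine ENNReal.toReal_le_of_le_ofReal hC ((measure_mono hsub).trans ?_)
  rw [Monotone.measure_iUnion fun m n hmn =>
    Set.biInter_subset_biInter_left fun k hk => hmn.trans hk]
  refine iSup_le fun N => (measure_mono (Set.biInter_subset_of_mem (le_refl N))).trans ?_
  rw [← ENNReal.ofReal_toReal (measure_ne_top (M.P s (some i)) (A N))]
  exact ENNReal.ofReal_le_ofReal (hAle N)

/-- Upward passage from a state outside `E₊` contracts exponentially decaying functions. -/
theorem exists_passage_contraction {K : ℝ} (hK : 0 < K) (hΛK : ∀ s i j, |Λ s i j| ≤ K) {c : ℝ}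
    (hc : 0 < c) : ∃ q : ℝ, 0 ≤ q ∧ q < 1 ∧
      ∀ (v : E → ℝ) (ℓ : ℝ≥0) (G : ℝ≥0 → E → ℝ) (C : ℝ), 0 ≤ C → IsBb G →
      (∀ t j, |G t j| ≤ C * Real.exp (-c * t)) →
      ∀ s i, ¬ 0 < v i → |passage M v ℓ G s i| ≤ q * (C * Real.exp (-c * s)) := by
  have hR : 0 < rateBound E K := by unfold rateBound; positivity
  -- within time `δ` the passage has probability at most `1 / 2`
  let δ : ℝ≥0 := ⟨1 / (2 * rateBound E K), by positivity⟩
  have hδ : rateBound E K * (δ : ℝ) = 1 / 2 := by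
    change rateBound E K * (1 / (2 * rateBound E K)) = 1 / 2
    field_simp
  have hδ0 : 0 < (δ : ℝ) := by
    change 0 < 1 / (2 * rateBound E K)
    positivity
  have he1 : Real.exp (-c * δ) < 1 := Real.exp_lt_one_iff.2 (by nlinarith)
  have he0 := Real.exp_pos (-c * δ)
  refine ⟨(1 + Real.exp (-c * δ)) / 2, by positivity, by linarith, ?_⟩
  intro v ℓ G C hC hG hdecay s i hi
  have hm := measurable_tauPlus (v := v) ℓ s
  set A := {ω : CadlagPath E | tauPlus v ℓ s ω < ((s + δ : ℝ≥0) : WithTop ℝ≥0)} with hA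
  have hAm : MeasurableSet A := measurableSet_Iio.preimage hm
  have hp := measureReal_tauPlus_lt_le M hΛK hi ℓ s δ
  rw [hδ, ← hA] at hp
  have hB0 : 0 ≤ C * Real.exp (-c * s) := by positivity
  have hint : Integrable (A.indicator (1 : CadlagPath E → ℝ)) (M.P s (some i)) :=
    (integrable_const (1 : ℝ)).indicator hAm
  calc |passage M v ℓ G s i|
      ≤ ∫ ω, |evalAtFull G (tauPlus v ℓ s ω) (coordTop ω (tauPlus v ℓ s ω))| ∂(M.P s (some i)) :=
        abs_integral_le_integral_abs
    _ ≤ ∫ ω, C * Real.exp (-c * s) * (Real.exp (-c * δ) +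
          (1 - Real.exp (-c * δ)) * A.indicator (1 : CadlagPath E → ℝ) ω) ∂(M.P s (some i)) := by
        refine integral_mono (integrable_eval hG hm _).abs
          (((integrable_const _).add (hint.const_mul _)).const_mul _) fun ω => ?_
        dsimp only
        have hind : 0 ≤ A.indicator (1 : CadlagPath E → ℝ) ω :=
          Set.indicator_nonneg (fun _ _ => zero_le_one) _
        have hR0 : 0 ≤ C * Real.exp (-c * s) * (Real.exp (-c * δ) +
          (1 - Real.exp (-c * δ)) * A.indicator (1 : CadlagPath E → ℝ) ω) :=
          mul_nonneg hB0 (add_nonneg he0.le (mul_nonneg (by linarith) hind))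
        cases hτ : tauPlus v ℓ s ω with
        | top => rw [evalAtFull_top, abs_zero]; exact hR0
        | coe t =>
          have hst : s ≤ t := WithTop.coe_le_coe.1 (hτ ▸ le_tauPlus ℓ s ω)
          have hst' : (s : ℝ) ≤ t := NNReal.coe_le_coe.2 hst
          change |evalAtFull G t (coord t ω)| ≤ _
          cases coord t ω with
          | none => simpa [evalAtFull] using hR0
          | some j =>
            refine (hdecay t j).trans ?_
            rw [mul_assoc]
            refine mul_le_mul_of_nonneg_left ?_ hC
            by_cases hω : ω ∈ A
            · rw [Set.indicator_of_mem hω, Pi.one_apply, mul_one, add_sub_cancel, mul_one]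
              exact Real.exp_le_exp.2 (by nlinarith)
            · rw [Set.indicator_of_notMem hω, mul_zero, add_zero, ← Real.exp_add]
              have h1 : s + δ ≤ t := by
                by_contra! h
                exact hω (by rw [hA, Set.mem_ofPred_eq, hτ]; exact WithTop.coe_lt_coe.2 h)
              have h2 : (s : ℝ) + δ ≤ t := by exact_mod_cast h1
              exact Real.exp_le_exp.2 (by nlinarith)
    _ = C * Real.exp (-c * s) * (Real.exp (-c * δ) +
          (1 - Real.exp (-c * δ)) * (M.P s (some i)).real A) := by
        rw [integral_const_mul, integral_add (integrable_const _) (hint.const_mul _),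
          integral_const_mul, integral_indicator_one hAm]
        simp
    _ ≤ C * Real.exp (-c * s) * (Real.exp (-c * δ) + (1 - Real.exp (-c * δ)) * (1 / 2)) := by
        gcongr
    _ = _ := by ring

end Jumps

/-! ### The exit operators in terms of the passage operators -/

section Reduction

open Classical in
/-- A function on `[0, ∞) × S`, `S ⊆ E`, extended by zero to `[0, ∞) × E`. -/
def extendZero {E : Type*} {p : E → Prop} (g : ℝ≥0 → {i : E // p i} → ℝ) : ℝ≥0 → E → ℝ :=
  fun t i => if h : p i then g t ⟨i, h⟩ else 0

theorem extendZero_of_pos {E : Type*} {p : E → Prop} (g : ℝ≥0 → {i : E // p i} → ℝ) (t : ℝ≥0)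
    {i : E} (h : p i) : extendZero g t i = g t ⟨i, h⟩ := dif_pos h

theorem extendZero_of_neg {E : Type*} {p : E → Prop} (g : ℝ≥0 → {i : E // p i} → ℝ) (t : ℝ≥0)
    {i : E} (h : ¬ p i) : extendZero g t i = 0 := dif_neg h

theorem evalAt_eq {E : Type*} {p : E → Prop} (g : ℝ≥0 → {i : E // p i} → ℝ) (t : WithTop ℝ≥0)
    (x : Option E) : evalAt g t x = evalAtFull (extendZero g) t x := by
  cases t <;> cases x <;> rfl

theorem IsBb.extendZero {E : Type*} {p : E → Prop} {g : ℝ≥0 → {i : E // p i} → ℝ} (hg : IsBb g) :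
    IsBb (extendZero g) := by
  obtain ⟨C, hC0, hC⟩ := hg.bound
  refine ⟨fun i => ?_, C, fun s i => ?_⟩
  · by_cases h : p i
    · simpa only [extendZero_of_pos g _ h] using hg.1 ⟨i, h⟩
    · simpa only [extendZero_of_neg g _ h] using measurable_const
  · by_cases h : p i
    · rw [extendZero_of_pos g _ h]
      exact hC s _
    · rw [extendZero_of_neg g _ h, abs_zero]
      exact hC0

theorem IsBb.restrict {E : Type*} (p : E → Prop) {G : ℝ≥0 → E → ℝ} (hG : IsBb G) :
    IsBb fun s (i : {i : E // p i}) => G s i :=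
  ⟨fun i => hG.1 i, hG.2.imp fun _ h s i => h s i⟩

variable {E : Type*} [Fintype E] {Λ : ℝ≥0 → Matrix E E ℝ} (M : StandardMarkovFamily E Λ)
  {v : E → ℝ}

theorem Jplus_eq {g : ℝ≥0 → EPlus v → ℝ} {G : ℝ≥0 → E → ℝ} (h : ∀ t (j : EPlus v), g t j = G t j) :
    Jplus M v g = fun s (i : EMinus v) => passage M v 0 G s i.1 := by
  funext s i
  rw [passage_congr (G := G) (G' := extendZero g) fun t i hi => by
    rw [extendZero_of_pos g t hi, h]]
  simp only [Jplus, passage, evalAt_eq]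

theorem Pplus_eq (ℓ : ℝ≥0) {g : ℝ≥0 → EPlus v → ℝ} {G : ℝ≥0 → E → ℝ}
    (h : ∀ t (j : EPlus v), g t j = G t j) :
    Pplus M v ℓ g = fun s (i : EPlus v) => passage M v ℓ G s i.1 := by
  funext s i
  rw [passage_congr (G := G) (G' := extendZero g) fun t i hi => by
    rw [extendZero_of_pos g t hi, h]]
  simp only [Pplus, passage, evalAt_eq]

theorem Jminus_eq {g : ℝ≥0 → EMinus v → ℝ} {G : ℝ≥0 → E → ℝ}
    (h : ∀ t (j : EMinus v), g t j = G t j) :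
    Jminus M v g = fun s (i : EPlus v) => passage M (-v) 0 G s i.1 := by
  funext s i
  rw [passage_congr (G := G) (G' := extendZero g) fun t i hi => by
    rw [extendZero_of_pos g t (neg_pos.1 hi), h]]
  simp only [Jminus, passage, evalAt_eq, tauMinus_eq]

theorem Pminus_eq (ℓ : ℝ≥0) {g : ℝ≥0 → EMinus v → ℝ} {G : ℝ≥0 → E → ℝ}
    (h : ∀ t (j : EMinus v), g t j = G t j) :
    Pminus M v ℓ g = fun s (i : EMinus v) => passage M (-v) ℓ G s i.1 := by
  funext s i
  rw [passage_congr (G := G) (G' := extendZero g) fun t i hi => by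
    rw [extendZero_of_pos g t (neg_pos.1 hi), h]]
  simp only [Pminus, passage, evalAt_eq, tauMinus_eq]

theorem XiPlus_eq (ℓm ℓp : ℝ≥0) {g : ℝ≥0 → EPlus v → ℝ} {G : ℝ≥0 → E → ℝ}
    (h : ∀ t (j : EPlus v), g t j = G t j) : XiPlus M v ℓm ℓp g = exitUp M v ℓm ℓp G := by
  funext s i
  rw [exitUp_congr (G := G) (G' := extendZero g) fun t i hi => by
    rw [extendZero_of_pos g t hi, h]]
  simp only [XiPlus, exitUp, evalAt_eq]

theorem XiMinus_eq (ℓm ℓp : ℝ≥0) {g : ℝ≥0 → EMinus v → ℝ} {G : ℝ≥0 → E → ℝ}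
    (h : ∀ t (j : EMinus v), g t j = G t j) :
    XiMinus M v ℓm ℓp g = exitUp M (-v) ℓp ℓm G := by
  funext s i
  rw [exitUp_congr (G := G) (G' := extendZero g) fun t i hi => by
    rw [extendZero_of_pos g t (neg_pos.1 hi), h]]
  simp only [XiMinus, exitUp, evalAt_eq, xiMinus_eq]

theorem colPlus_Pplus_eq (hv : ∀ i, v i ≠ 0) (ℓ : ℝ≥0) {g : ℝ≥0 → EPlus v → ℝ}
    {G : ℝ≥0 → E → ℝ} (hG : IsBb G) (h : ∀ t (j : EPlus v), g t j = G t j) :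
    colPlus M v (Pplus M v ℓ g) = passage M v ℓ G := by
  funext s i
  rw [Pplus_eq M ℓ h]
  unfold colPlus stack
  split_ifs with h1 h2
  · rfl
  · rw [Jplus_eq M (G := passage M v ℓ G) fun _ _ => rfl, passage_zero_passage ℓ hG]
  · exact absurd (le_antisymm (not_lt.1 h1) (not_lt.1 h2)) (hv i)

theorem colMinus_Pminus_eq (hv : ∀ i, v i ≠ 0) (ℓ : ℝ≥0) {g : ℝ≥0 → EMinus v → ℝ}
    {G : ℝ≥0 → E → ℝ} (hG : IsBb G) (h : ∀ t (j : EMinus v), g t j = G t j) :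
    colMinus M v (Pminus M v ℓ g) = passage M (-v) ℓ G := by
  funext s i
  rw [Pminus_eq M ℓ h]
  unfold colMinus stack
  split_ifs with h1 h2
  · rw [Jminus_eq M (G := passage M (-v) ℓ G) fun _ _ => rfl, passage_zero_passage ℓ hG]
  · rfl
  · exact absurd (le_antisymm (not_lt.1 h1) (not_lt.1 h2)) (hv i)

theorem Jplus_Pplus_eq (ℓ : ℝ≥0) {g : ℝ≥0 → EPlus v → ℝ} {G : ℝ≥0 → E → ℝ} (hG : IsBb G)
    (h : ∀ t (j : EPlus v), g t j = G t j) :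
    Jplus M v (Pplus M v ℓ g) = fun s (i : EMinus v) => passage M v ℓ G s i.1 := by
  rw [Pplus_eq M ℓ h, Jplus_eq M (G := passage M v ℓ G) fun _ _ => rfl, passage_zero_passage ℓ hG]

theorem Jminus_Pminus_eq (ℓ : ℝ≥0) {g : ℝ≥0 → EMinus v → ℝ} {G : ℝ≥0 → E → ℝ} (hG : IsBb G)
    (h : ∀ t (j : EMinus v), g t j = G t j) :
    Jminus M v (Pminus M v ℓ g) = fun s (i : EPlus v) => passage M (-v) ℓ G s i.1 := by
  rw [Pminus_eq M ℓ h, Jminus_eq M (G := passage M (-v) ℓ G) fun _ _ => rfl,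
    passage_zero_passage ℓ hG]

theorem loopPlus_eq (ℓ : ℝ≥0) {g : ℝ≥0 → EPlus v → ℝ} {G : ℝ≥0 → E → ℝ} (hG : IsBb G)
    (h : ∀ t (j : EPlus v), g t j = G t j) :
    loopPlus M v ℓ g = fun s (i : EPlus v) => passage M (-v) ℓ (passage M v ℓ G) s i.1 := by
  rw [loopPlus, Jplus_Pplus_eq M ℓ hG h,
    Jminus_Pminus_eq M ℓ (isBb_passage ℓ hG) fun _ _ => rfl]

theorem loopMinus_eq (ℓ : ℝ≥0) {g : ℝ≥0 → EMinus v → ℝ} {G : ℝ≥0 → E → ℝ} (hG : IsBb G)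
    (h : ∀ t (j : EMinus v), g t j = G t j) :
    loopMinus M v ℓ g = fun s (i : EMinus v) => passage M v ℓ (passage M (-v) ℓ G) s i.1 := by
  rw [loopMinus, Jminus_Pminus_eq M ℓ hG h,
    Jplus_Pplus_eq M ℓ (isBb_passage ℓ hG) fun _ _ => rfl]

end Reduction

/-! ### The series -/

section Series

variable {E : Type*} [Fintype E] {Λ : ℝ≥0 → Matrix E E ℝ} {M : StandardMarkovFamily E Λ}
  {v : E → ℝ}

theorem isBb_tsum {S : Type*} {a : ℕ → ℝ≥0 → S → ℝ} (ha : ∀ n, IsBb (a n)) {b : ℕ → ℝ}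
    (hb : Summable b) (hab : ∀ n t j, |a n t j| ≤ b n) : IsBb fun t j => ∑' n, a n t j := by
  have hs : ∀ t j, Summable fun n => a n t j := fun t j =>
    Summable.of_norm_bounded hb fun n => hab n t j
  refine ⟨fun i => ?_, ∑' n, b n, fun s i => ?_⟩
  · exact measurable_of_tendsto_metrizable
      (f := fun N s => ∑ n ∈ Finset.range N, a n s i)
      (fun N => Finset.measurable_sum _ fun n _ => (ha n).1 i)
      (tendsto_pi_nhds.2 fun s => (hs s i).hasSum.tendsto_sum_nat)
  · exact tsum_of_norm_bounded (f := fun n => a n s i) hb.hasSum fun n => hab n s i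

/-- The solution of the two-sided exit problem. The upward passage operators `H⁺`, the downward
passage operators `H⁻` and the exit operators `X⁺`, `X⁻` satisfy `H⁺ = X⁺ + X⁻ T⁺` and
`H⁻ = X⁻ + X⁺ T⁻`, where `T^±` are the passage operators over the full width of the interval. Hence
`H⁺ - H⁻ T⁺ = X⁺ (1 - T⁻ T⁺)`, and the series inverts `1 - T⁻ T⁺`. -/
theorem exitUp_eq_of_series (ℓm ℓp : ℝ≥0) {a : ℕ → ℝ≥0 → E → ℝ} (ha : ∀ n, IsBb (a n))
    {b : ℕ → ℝ} (hb : Summable b) (hab : ∀ n t j, |a n t j| ≤ b n)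
    (hstep : ∀ n s i, 0 < v i → a (n + 1) s i =
      passage M (-v) (ℓm + ℓp) (passage M v (ℓm + ℓp) (a n)) s i) (s : ℝ≥0) (i : E) :
    exitUp M v ℓm ℓp (a 0) s i = passage M v ℓp (fun t j => ∑' n, a n t j) s i -
      passage M (-v) ℓm (passage M v (ℓm + ℓp) (fun t j => ∑' n, a n t j)) s i := by
  have hb0 : ∀ n, 0 ≤ b n := fun n => (abs_nonneg _).trans (hab n s i)
  set N : ℝ≥0 → E → ℝ := fun t j => ∑' n, a n t j with hN
  have hNb : IsBb N := isBb_tsum ha hb hab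
  have hT := isBb_passage (M := M) (v := v) (ℓm + ℓp) hNb
  have hTT := isBb_passage (M := M) (v := -v) (ℓm + ℓp) hT
  -- the series solves `N = a 0 + T⁻ T⁺ N` on `E₊`
  have hfix : ∀ t j, 0 < v j →
      a 0 t j = N t j - passage M (-v) (ℓm + ℓp) (passage M v (ℓm + ℓp) N) t j := by
    intro t j hj
    have h1 : passage M v (ℓm + ℓp) N = fun t j => ∑' n, passage M v (ℓm + ℓp) (a n) t j :=
      funext fun t => funext fun j => (hasSum_passage ha hb hb0 hab _ t j).tsum_eq.symm
    have h2 : HasSum (fun n => a (n + 1) t j)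
        (passage M (-v) (ℓm + ℓp) (passage M v (ℓm + ℓp) N) t j) := by
      rw [h1]
      simp only [hstep _ t j hj]
      exact hasSum_passage (fun n => isBb_passage _ (ha n)) hb hb0
        (fun n t j => abs_passage_le (hb0 n) fun t _ j => hab n t j) _ t j
    have h3 : Summable fun n => a n t j := Summable.of_norm_bounded hb fun n => hab n t j
    have h4 : N t j = a 0 t j + _ := h3.tsum_eq_zero_add
    rw [h4, h2.tsum_eq, add_sub_cancel_right]
  rw [exitUp_congr hfix, exitUp_sub hNb hTT, passage_eq_exitUp_add ℓm ℓp hNb,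
    passage_eq_exitUp_add (v := -v) ℓp ℓm hT, neg_neg, add_comm ℓp ℓm]
  ring

/-- The iterates of the loop operator decay geometrically on exponentially decaying functions: each
loop contains a passage that starts on the wrong side. -/
theorem exists_iterate_bound {K : ℝ} (hK : 0 < K) (hΛK : ∀ s i j, |Λ s i j| ≤ K) (ℓ : ℝ≥0)
    {a : ℕ → ℝ≥0 → E → ℝ} (ha : ∀ n, IsBb (a n)) {C c : ℝ} (hC : 0 < C) (hc : 0 < c)
    (h0 : ∀ t j, |a 0 t j| ≤ C * Real.exp (-c * t)) (hzero : ∀ n t j, ¬ 0 < v j → a n t j = 0)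
    (hstep : ∀ n s i, 0 < v i → a (n + 1) s i = passage M (-v) ℓ (passage M v ℓ (a n)) s i) :
    ∃ b : ℕ → ℝ, Summable b ∧ ∀ n t j, |a n t j| ≤ b n := by
  obtain ⟨q, hq0, hq1, hq⟩ := exists_passage_contraction M hK hΛK hc
  refine ⟨fun n => C * q ^ n, (summable_geometric_of_lt_one hq0 hq1).mul_left C, ?_⟩
  have key : ∀ n t j, |a n t j| ≤ C * q ^ n * Real.exp (-c * t) := by
    intro n
    induction n with
    | zero => simpa using h0
    | succ n ih =>
      intro t j
      have hCq : 0 ≤ C * q ^ n := by positivity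
      by_cases hj : 0 < v j
      · rw [hstep n t j hj]
        have h1 : ∀ s i, |passage M v ℓ (a n) s i| ≤ C * q ^ n * Real.exp (-c * s) := fun s i =>
          abs_passage_le (by positivity) fun u hu k => (ih u k).trans (by
            have : (s : ℝ) ≤ u := NNReal.coe_le_coe.2 hu
            exact mul_le_mul_of_nonneg_left (Real.exp_le_exp.2 (by nlinarith)) hCq)
        have h2 := hq (-v) ℓ (passage M v ℓ (a n)) (C * q ^ n) hCq (isBb_passage ℓ (ha n)) h1 t j
          (by simpa using hj.le)
        refine h2.trans_eq ?_
        ring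
      · rw [hzero (n + 1) t j hj, abs_zero]
        positivity
  intro n t j
  refine (key n t j).trans (mul_le_of_le_one_right (by positivity) (Real.exp_le_one_iff.2 ?_))
  nlinarith [NNReal.coe_nonneg t]

theorem neumann_eq_tsum_extendZero {E : Type*} {p : E → Prop}
    (A : (ℝ≥0 → {i // p i} → ℝ) → (ℝ≥0 → {i // p i} → ℝ)) (g : ℝ≥0 → {i // p i} → ℝ) (t : ℝ≥0)
    (j : {i // p i}) :
    neumann A g t j = ∑' n, extendZero (A^[n] g) t j.1 := by
  simp only [extendZero_of_pos _ t j.2, neumann]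

theorem neumannConverges_of_bound {E : Type*} {p : E → Prop}
    {A : (ℝ≥0 → {i // p i} → ℝ) → (ℝ≥0 → {i // p i} → ℝ)} {g : ℝ≥0 → {i // p i} → ℝ} {b : ℕ → ℝ}
    (hb : Summable b) (hab : ∀ n t j, |extendZero (A^[n] g) t j| ≤ b n) : NeumannConverges A g :=
  tendstoUniformly_tsum_nat hb fun n z => by
    have := hab n z.1 z.2
    rwa [extendZero_of_pos _ _ z.2.2] at this

theorem abs_extendZero_le_of_expDecay {E : Type*} {p : E → Prop} {g : ℝ≥0 → {i // p i} → ℝ}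
    {C c : ℝ} (hC : 0 < C) (h : ∀ s i, |g s i| ≤ C * Real.exp (-c * s)) (t : ℝ≥0) (j : E) :
    |extendZero g t j| ≤ C * Real.exp (-c * t) := by
  by_cases hj : p j
  · rw [extendZero_of_pos g t hj]
    exact h t _
  · rw [extendZero_of_neg g t hj, abs_zero]
    positivity

end Series

end TwoSidedExit

end

theorem theorem3p2 {E : Type*} [Fintype E] (Λ : ℝ≥0 → Matrix E E ℝ)
    (hΛ : IsSubMarkovGenerator Λ) (K : ℝ) (hK : 0 < K) (hΛK : ∀ s i j, |Λ s i j| ≤ K)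
    (v : E → ℝ) (hv : ∀ i, v i ≠ 0) (hplus : Nonempty (EPlus v)) (hminus : Nonempty (EMinus v))
    (M : StandardMarkovFamily E Λ) (ℓm ℓp : ℝ≥0) :
    -- the operators act between the spaces of bounded Borel functions
    ((∀ g : ℝ≥0 → EPlus v → ℝ, IsBb g →
        IsBb (Jplus M v g) ∧ (∀ ℓ, IsBb (Pplus M v ℓ g)) ∧ IsBb (XiPlus M v ℓm ℓp g)) ∧
      (∀ g : ℝ≥0 → EMinus v → ℝ, IsBb g →
        IsBb (Jminus M v g) ∧ (∀ ℓ, IsBb (Pminus M v ℓ g)) ∧ IsBb (XiMinus M v ℓm ℓp g))) ∧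
    -- the formula for `Ξ⁺`
    (∀ g : ℝ≥0 → EPlus v → ℝ, IsBb g → ExpDecay g →
      NeumannConverges (loopPlus M v (ℓm + ℓp)) g ∧
      ∀ s i, XiPlus M v ℓm ℓp g s i =
        colPlus M v (Pplus M v ℓp (neumann (loopPlus M v (ℓm + ℓp)) g)) s i -
        colMinus M v (Pminus M v ℓm (Jplus M v (Pplus M v (ℓm + ℓp)
          (neumann (loopPlus M v (ℓm + ℓp)) g)))) s i) ∧
    -- the formula for `Ξ⁻`
    (∀ g : ℝ≥0 → EMinus v → ℝ, IsBb g → ExpDecay g →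
      NeumannConverges (loopMinus M v (ℓm + ℓp)) g ∧
      ∀ s i, XiMinus M v ℓm ℓp g s i =
        colMinus M v (Pminus M v ℓm (neumann (loopMinus M v (ℓm + ℓp)) g)) s i -
        colPlus M v (Pplus M v ℓp (Jminus M v (Pminus M v (ℓm + ℓp)
          (neumann (loopMinus M v (ℓm + ℓp)) g)))) s i) ∧
    -- the two-sided exit problem
    (∀ g : ℝ≥0 → E → ℝ, IsBb g → ∀ s i, twoSidedExit M v ℓm ℓp g s i =
      XiPlus M v ℓm ℓp (fun t j => g t j) s i + XiMinus M v ℓm ℓp (fun t j => g t j) s i) := by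
  have hext : ∀ {p : E → Prop} (g : ℝ≥0 → {i // p i} → ℝ) (t : ℝ≥0) (j : {i // p i}),
      g t j = extendZero g t j := fun g t j => (extendZero_of_pos g t j.2).symm
  refine ⟨⟨fun g hg => ⟨?_, fun ℓ => ?_, ?_⟩, fun g hg => ⟨?_, fun ℓ => ?_, ?_⟩⟩, ?_, ?_, ?_⟩
  · rw [Jplus_eq M (hext g)]
    exact (isBb_passage 0 hg.extendZero).restrict _
  · rw [Pplus_eq M ℓ (hext g)]
    exact (isBb_passage ℓ hg.extendZero).restrict _
  · rw [XiPlus_eq M ℓm ℓp (hext g)]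
    exact isBb_exitUp ℓm ℓp hg.extendZero
  · rw [Jminus_eq M (hext g)]
    exact (isBb_passage 0 hg.extendZero).restrict _
  · rw [Pminus_eq M ℓ (hext g)]
    exact (isBb_passage ℓ hg.extendZero).restrict _
  · rw [XiMinus_eq M ℓm ℓp (hext g)]
    exact isBb_exitUp ℓp ℓm hg.extendZero
  · rintro g hg ⟨C, c, hC, hc, hdecay⟩
    have hL : ∀ h, IsBb h → loopPlus M v (ℓm + ℓp) h =
        fun s (i : EPlus v) =>
          passage M (-v) (ℓm + ℓp) (passage M v (ℓm + ℓp) (extendZero h)) s i.1 :=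
      fun h hh => loopPlus_eq M _ hh.extendZero (hext h)
    have hbb : ∀ n, IsBb ((loopPlus M v (ℓm + ℓp))^[n] g) := by
      intro n
      induction n with
      | zero => exact hg
      | succ n ih =>
        rw [Function.iterate_succ_apply', hL _ ih]
        exact (isBb_passage _ (isBb_passage _ ih.extendZero)).restrict _
    have ha := fun n => (hbb n).extendZero
    have hstep : ∀ n s i, 0 < v i → extendZero ((loopPlus M v (ℓm + ℓp))^[n + 1] g) s i =
        passage M (-v) (ℓm + ℓp) (passage M v (ℓm + ℓp)
          (extendZero ((loopPlus M v (ℓm + ℓp))^[n] g))) s i := by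
      intro n s i hi
      rw [extendZero_of_pos ((loopPlus M v (ℓm + ℓp))^[n + 1] g) s hi,
        Function.iterate_succ_apply', hL _ (hbb n)]
    obtain ⟨b, hb, hab⟩ := exists_iterate_bound hK hΛK (ℓm + ℓp) ha hC hc
      (abs_extendZero_le_of_expDecay hC hdecay) (fun n t j hj => extendZero_of_neg _ t hj) hstep
    have hN := isBb_tsum ha hb hab
    have hNeq := neumann_eq_tsum_extendZero (loopPlus M v (ℓm + ℓp)) g
    refine ⟨neumannConverges_of_bound hb hab, fun s i => ?_⟩
    rw [XiPlus_eq M ℓm ℓp (hext g), colPlus_Pplus_eq M hv ℓp hN hNeq,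
      Jplus_Pplus_eq M _ hN hNeq,
      colMinus_Pminus_eq M hv ℓm (isBb_passage _ hN) fun _ _ => rfl]
    exact exitUp_eq_of_series ℓm ℓp ha hb hab hstep s i
  · rintro g hg ⟨C, c, hC, hc, hdecay⟩
    have hL : ∀ h, IsBb h → loopMinus M v (ℓm + ℓp) h =
        fun s (i : EMinus v) =>
          passage M v (ℓm + ℓp) (passage M (-v) (ℓm + ℓp) (extendZero h)) s i.1 :=
      fun h hh => loopMinus_eq M _ hh.extendZero (hext h)
    have hbb : ∀ n, IsBb ((loopMinus M v (ℓm + ℓp))^[n] g) := by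
      intro n
      induction n with
      | zero => exact hg
      | succ n ih =>
        rw [Function.iterate_succ_apply', hL _ ih]
        exact (isBb_passage _ (isBb_passage _ ih.extendZero)).restrict _
    have ha := fun n => (hbb n).extendZero
    -- the mirror image: the same argument for `-v` with the two ends of the interval exchanged
    have hstep : ∀ n s i, 0 < (-v) i → extendZero ((loopMinus M v (ℓm + ℓp))^[n + 1] g) s i =
        passage M (- -v) (ℓp + ℓm) (passage M (-v) (ℓp + ℓm)
          (extendZero ((loopMinus M v (ℓm + ℓp))^[n] g))) s i := by
      intro n s i hi
      rw [extendZero_of_pos ((loopMinus M v (ℓm + ℓp))^[n + 1] g) s (neg_pos.1 hi),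
        Function.iterate_succ_apply', hL _ (hbb n), neg_neg, add_comm ℓp ℓm]
    obtain ⟨b, hb, hab⟩ := exists_iterate_bound hK hΛK (ℓp + ℓm) ha hC hc
      (abs_extendZero_le_of_expDecay hC hdecay)
      (fun n t j hj => extendZero_of_neg _ t fun h => hj (neg_pos.2 h)) hstep
    have hN := isBb_tsum ha hb hab
    have hNeq := neumann_eq_tsum_extendZero (loopMinus M v (ℓm + ℓp)) g
    refine ⟨neumannConverges_of_bound hb hab, fun s i => ?_⟩
    rw [XiMinus_eq M ℓm ℓp (hext g), colMinus_Pminus_eq M hv ℓm hN hNeq,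
      Jminus_Pminus_eq M _ hN hNeq,
      colPlus_Pplus_eq M hv ℓp (isBb_passage _ hN) fun _ _ => rfl]
    have h := exitUp_eq_of_series ℓp ℓm ha hb hab hstep s i
    rwa [neg_neg, add_comm ℓp ℓm] at h
  · intro g hg s i
    rw [twoSidedExit_eq ℓm ℓp hg, XiPlus_eq M ℓm ℓp (G := g) fun _ _ => rfl,
      XiMinus_eq M ℓm ℓp (G := g) fun _ _ => rfl]
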